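/- For a positive trace-class operator $\Sigma$ on a real separable Hilbert space let $\lambda_1(\Sigma)\ge\lambda_2(\Sigma)\ge\dots\ge 0$ be its eigenvalues, counted with multiplicity and arranged in non-increasing order (positive eigenvalues first; if there are only finitely many positive ones, the list is continued by zeros). Put $\Lambda_k(\Sigma)^2=\sum_{j\ge k}\lambda_j(\Sigma)^2$ for $k=1,2$, and $$ \varkappa(\Sigma)=\begin{cases} \Lambda_1^{-1}, & \text{if } 3\lambda_1^2\le\Lambda_1^2,\\ (\lambda_1\Lambda_2)^{-1/2}, & \text{if } 3\lambda_1^2>\Lambda_1^2 \text{ and } 3\lambda_2^2\le\Lambda_2^2,\\ (\lambda_1\lambda_2)^{-1/2}, & \text{if } 3\lambda_1^2>\Lambda_1^2 \text{ and } 3\lambda_2^2>\Lambda_2^2, \end{cases} $$ with values in $(0,\infty]$, where negative powers of $0$ equal $\infty$ (so $\varkappa(\Sigma)=\infty$ if and only if $\Sigma$ has rank at most one). There is an absolute constant $C<\infty$ such that the following holds. Let $H$ be a real separable Hilbert space, let $\xi,\eta$ be Gaussian random elements of $H$ with mean zero, defined on a common probability space, with covariance operators $\Sigma_\xi,\Sigma_\eta$,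 and let $a\in H$. Then $$ \sup_{x>0}\bigl|P(\|\xi-a\|\le x)-P(\|\eta\|\le x)\bigr|\le C\,\bigl\{\varkappa(\Sigma_\xi)+\varkappa(\Sigma_\eta)\bigr\}\Bigl(\sum_{j\ge1}|\lambda_j(\Sigma_\xi)-\lambda_j(\Sigma_\eta)|+\|a\|^2\Bigr), $$ with the convention $\infty\cdot 0=0$ on the right-hand side. Moreover, for the covariance operator $\Sigma_\xi$ of every centered Gaussian random element $\xi$ of a real separable Hilbert space, $$ \frac{0.9}{(\Lambda_1(\Sigma_\xi)\Lambda_2(\Sigma_\xi))^{1/2}}\le\varkappa(\Sigma_\xi)\le\frac{1.8}{(\Lambda_1(\Sigma_\xi)\Lambda_2(\Sigma_\xi))^{1/2}} . $$ -/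

import Mathlib

open MeasureTheory ProbabilityTheory
open scoped NNReal ENNReal

universe u v

noncomputable section

namespace GaussianComparison

variable {H : Type*} [NormedAddCommGroup H] [InnerProductSpace ℝ H]

/-- The (algebraic) span of all eigenvectors of `T` with eigenvalue at least `t`. As eigenspaces
for different eigenvalues are independent, its dimension is the number of eigenvalues of `T` in
`[t, ∞)`, counted with multiplicity. -/
def upperEigenspace (T : H →L[ℝ] H) (t : ℝ) : Submodule ℝ H :=
  ⨆ s ∈ Set.Ici t, Module.End.eigenspace (T : Module.End ℝ H) s

/-- The eigenvalues of a positive compact operator `T`, counted with multiplicity and arranged in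
non-increasing order: `orderedEigenvalue T n` (`n = 0, 1, 2, …`) is the `(n + 1)`-st largest one,
i.e. the largest `t > 0` such that at least `n + 1` eigenvalues are `≥ t`. If `T` has at most `n`
positive eigenvalues then the set is empty and the value is `sSup ∅ = 0`: a finite list of
positive eigenvalues is continued by zeros. -/
def orderedEigenvalue (T : H →L[ℝ] H) (n : ℕ) : ℝ :=
  sSup {t : ℝ | 0 < t ∧ ((n + 1 : ℕ) : Cardinal) ≤ Module.rank ℝ (upperEigenspace T t)}

/-- `tailNorm T k` is the `ℓ²` norm of the sequence of ordered eigenvalues from index `k` on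
(indices start at `0`). Thus `Λ₁ = tailNorm T 0` and `Λ₂ = tailNorm T 1`. -/
def tailNorm (T : H →L[ℝ] H) (k : ℕ) : ℝ≥0∞ :=
  (∑' j : ℕ, ENNReal.ofReal (orderedEigenvalue T (k + j)) ^ 2) ^ (1 / 2 : ℝ)

/-- The spectral quantity `ϰ(T)`, with values in `(0, ∞]`; negative powers of `0` are `∞`, so
`ϰ(T) = ∞` exactly when `T` has at most one positive eigenvalue. -/
def kappa (T : H →L[ℝ] H) : ℝ≥0∞ :=
  if 3 * ENNReal.ofReal (orderedEigenvalue T 0) ^ 2 ≤ tailNorm T 0 ^ 2 then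
    (tailNorm T 0)⁻¹
  else if 3 * ENNReal.ofReal (orderedEigenvalue T 1) ^ 2 ≤ tailNorm T 1 ^ 2 then
    (ENNReal.ofReal (orderedEigenvalue T 0) * tailNorm T 1) ^ (-(1 / 2) : ℝ)
  else
    (ENNReal.ofReal (orderedEigenvalue T 0) * ENNReal.ofReal (orderedEigenvalue T 1)) ^
      (-(1 / 2) : ℝ)

/-- The `ℓ¹` distance between the ordered eigenvalue sequences of `S` and `T`. -/
def eigenvalueDist (S T : H →L[ℝ] H) : ℝ≥0∞ :=
  ∑' j : ℕ, ENNReal.ofReal |orderedEigenvalue S j - orderedEigenvalue T j|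

end GaussianComparison

end

noncomputable section

namespace GaussianComparison

/-! ### Shifting a one-dimensional centred Gaussian variable -/

/-! Everything rests on one anti-concentration fact: the squared distance of ξ to any point,
computed in sufficiently many eigencoordinates, has a Lebesgue density bounded by M = C·ϰ(Σ_ξ), with
the same M for all points.

Given this, balls are compared coordinate by coordinate. For Z ~ N(0, v), the function −d/dt P((Z −
t)² ≤ y) is 2t times the density at y of (Z − t)² + E, where E is an independent exponential
variable of rate 1/(2v); this is the noncentral χ² identity, E being v times a χ² variable with two
degrees of freedom (`gaussianReal_sq_le_eq_add`). Adding independent variables preserves a density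
bound, so removing a shift c from one coordinate raises the ball probability by at least 0
(Anderson) and at most ∫₀^|c| 2tM dt = Mc². Hence the cost is quadratic in a. Raising a variance by
w amounts to adding an independent random shift of mean square w, so it lowers the probability by at
most Mw (`map_sqDist_Iic_le_add`). Two variance sequences are compared by raising both to their
pointwise maximum, which produces the ℓ¹ distance.

The density bound is Fourier-analytic: |E exp(it(Z − b)²)| ≤ (1 + 4v²t²)^(−1/4) uniformly in b. If
no eigenvalue dominates, the product of these factors is integrable, with integral of order 1/Λ₁
(`prod_rpow_le`). If only λ₁ dominates, its factor is replaced by (2λ₁|t|)^(−1/2). If λ₁ and λ₂ both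
dominate, the product need not decay faster than 1/|t|; instead the planar Gaussian density is at
most 1/(2π√(λ₁λ₂)), and circular annuli have area π times the difference of squared radii
(`map_sq_add_sq_le`).

The Hilbert space enters only through an eigenbasis of the covariance
(`exists_gaussian_coordinates`) and a limit over the number of coordinates. -/

lemma setOf_sq_sub_le {y : ℝ} (hy : 0 ≤ y) (c : ℝ) :
    {z : ℝ | (z - c) ^ 2 ≤ y} = Set.Icc (c - √y) (c + √y) := by
  ext z
  rw [Set.mem_ofPred_eq, Set.mem_Icc, Real.sq_le hy]
  constructor <;> rintro ⟨h₁, h₂⟩ <;> constructor <;> linarith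

lemma gaussianReal_Icc {v : ℝ≥0} (hv : v ≠ 0) {p q : ℝ} (h : p ≤ q) :
    gaussianReal 0 v (Set.Icc p q) = ENNReal.ofReal (∫ x in p..q, gaussianPDFReal 0 v x) := by
  rw [gaussianReal_apply_eq_integral _ hv, integral_Icc_eq_integral_Ioc,
    intervalIntegral.integral_of_le h]

lemma continuous_gaussianPDFReal (v : ℝ≥0) : Continuous (gaussianPDFReal 0 v) := by
  rw [gaussianPDFReal_def]; fun_prop

lemma gaussianPDFReal_sub_le {v : ℝ≥0} {r t : ℝ} (hr : 0 ≤ r) (ht : 0 ≤ t) :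
    gaussianPDFReal 0 v (t + r) ≤ gaussianPDFReal 0 v (t - r) := by
  simp only [gaussianPDFReal]
  gcongr ?_ * Real.exp (?_ / _)
  nlinarith [mul_nonneg hr ht]

/-- On (z − t)² ≤ y the quadratic exponents of the Gaussian and exponential densities cancel. What
remains is the exponential of an affine function of z, whose primitive takes the Gaussian density
values at the endpoints t ± √y. -/
lemma lintegral_exponentialPDF_sq_sub {v : ℝ≥0} (hv : v ≠ 0) {y t : ℝ} (hy : 0 ≤ y)
    (ht : 0 ≤ t) :
    ENNReal.ofReal (2 * t) *
        ∫⁻ z, exponentialPDF (1 / (2 * v)) (y - (z - t) ^ 2) ∂(gaussianReal 0 v) =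
      ENNReal.ofReal (gaussianPDFReal 0 v (t - √y) - gaussianPDFReal 0 v (t + √y)) := by
  have hv' : (0 : ℝ) < v := by positivity
  set K : ℝ := (√(2 * Real.pi * v))⁻¹
  set g : ℝ → ℝ := fun z ↦ K * (t / v) * Real.exp ((-y + t ^ 2) / (2 * v) - z * t / v) with hg
  have hg0 (z : ℝ) : 0 ≤ g z := by positivity
  have hgc : Continuous g := by fun_prop
  have h1 (z : ℝ) : gaussianPDF 0 v z *
      (ENNReal.ofReal (2 * t) * exponentialPDF (1 / (2 * v)) (y - (z - t) ^ 2)) =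
      (Set.Icc (t - √y) (t + √y)).indicator (fun z ↦ ENNReal.ofReal (g z)) z := by
    rw [← setOf_sq_sub_le hy]
    rw [exponentialPDF_eq, gaussianPDF, ← ENNReal.ofReal_mul (by positivity),
      ← ENNReal.ofReal_mul (gaussianPDFReal_nonneg _ _ _)]
    by_cases hz : (z - t) ^ 2 ≤ y
    · rw [Set.indicator_of_mem (by exact hz), if_pos (by linarith)]
      congr 1
      simp only [gaussianPDFReal, hg]
      have : Real.exp ((-y + t ^ 2) / (2 * v) - z * t / v) =
          Real.exp (-(z - 0) ^ 2 / (2 * v)) * Real.exp (-(1 / (2 * v) * (y - (z - t) ^ 2))) := by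
        rw [← Real.exp_add]
        congr 1
        field_simp
        ring
      rw [this]
      simp only [K]
      ring
    · rw [Set.indicator_of_notMem (by exact hz), if_neg (by linarith)]
      simp
  rw [← lintegral_const_mul' _ _ ENNReal.ofReal_ne_top, gaussianReal_of_var_ne_zero _ hv,
    lintegral_withDensity_eq_lintegral_mul₀ (by fun_prop)
      (by unfold exponentialPDF exponentialPDFReal
          exact (((measurable_gammaPDFReal _ _).ennreal_ofReal.comp (by fun_prop)).const_mul
            _).aemeasurable)]
  simp only [Pi.mul_apply, h1]
  have hle : t - √y ≤ t + √y := by linarith [Real.sqrt_nonneg y]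
  rw [lintegral_indicator measurableSet_Icc, ← ofReal_integral_eq_lintegral_ofReal
    (hgc.integrableOn_Icc) (Filter.Eventually.of_forall hg0), integral_Icc_eq_integral_Ioc,
    ← intervalIntegral.integral_of_le hle]
  congr 1
  rw [intervalIntegral.integral_eq_sub_of_hasDerivAt
    (f := fun z ↦ -(K * Real.exp ((-y + t ^ 2) / (2 * v) - z * t / v)))]
  · have e1 : (-y + t ^ 2) / (2 * v) - (t + √y) * t / v = -(t + √y - 0) ^ 2 / (2 * v) := by
      field_simp
      nlinarith [Real.sq_sqrt hy]
    have e2 : (-y + t ^ 2) / (2 * v) - (t - √y) * t / v = -(t - √y - 0) ^ 2 / (2 * v) := by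
      field_simp
      nlinarith [Real.sq_sqrt hy]
    simp only [gaussianPDFReal, e1, e2, K]
    ring
  · intro z _
    have h : HasDerivAt (fun z : ℝ ↦ (-y + t ^ 2) / (2 * v) - z * t / v) (-(1 * t / v)) z :=
      (((hasDerivAt_id z).mul_const t).div_const (v : ℝ)).const_sub _
    refine (h.exp.const_mul K).fun_neg.congr_deriv ?_
    simp only [hg]
    ring
  · exact hgc.intervalIntegrable _ _

/-- The inner expression is minus the t-derivative of the Gaussian mass of [t − √y, t + √y];
integrating it from 0 to c gives the difference of masses. -/
lemma gaussianReal_sq_le_eq_add {v : ℝ≥0} (hv : v ≠ 0) {c : ℝ} (hc : 0 ≤ c) (y : ℝ) :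
    gaussianReal 0 v {z | (z - 0) ^ 2 ≤ y} = gaussianReal 0 v {z | (z - c) ^ 2 ≤ y} +
      ∫⁻ t in Set.Ioc 0 c, ENNReal.ofReal (2 * t) *
        ∫⁻ z, exponentialPDF (1 / (2 * v)) (y - (z - t) ^ 2) ∂(gaussianReal 0 v) := by
  rcases lt_or_ge y 0 with hy | hy
  · have h1 (c : ℝ) : {z : ℝ | (z - c) ^ 2 ≤ y} = ∅ := by
      ext z; simpa using hy.trans_le (sq_nonneg _)
    have h2 (t z : ℝ) : exponentialPDF (1 / (2 * v)) (y - (z - t) ^ 2) = 0 := by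
      rw [exponentialPDF_eq, if_neg (by nlinarith [sq_nonneg (z - t)]), ENNReal.ofReal_zero]
    simp only [h1, h2, measure_empty, lintegral_zero, mul_zero, add_zero]
  · have hc' := continuous_gaussianPDFReal v
    have hc₁ (s : ℝ) : Continuous fun t ↦ gaussianPDFReal 0 v (t - s) := hc'.comp (by fun_prop)
    have hc₂ (s : ℝ) : Continuous fun t ↦ gaussianPDFReal 0 v (t + s) := hc'.comp (by fun_prop)
    have hi (p q : ℝ) : IntervalIntegrable (gaussianPDFReal 0 v) volume p q :=
      hc'.intervalIntegrable _ _
    have hs := Real.sqrt_nonneg y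
    set r := √y with hr
    rw [setLIntegral_congr_fun measurableSet_Ioc
      (fun t ht ↦ lintegral_exponentialPDF_sq_sub hv hy ht.1.le), setOf_sq_sub_le hy,
      setOf_sq_sub_le hy, ← hr, gaussianReal_Icc hv (by linarith), gaussianReal_Icc hv (by linarith)]
    have hcont : Continuous fun t ↦ gaussianPDFReal 0 v (t - r) - gaussianPDFReal 0 v (t + r) :=
      (hc₁ r).sub (hc₂ r)
    rw [← ofReal_integral_eq_lintegral_ofReal]
    rotate_left
    · exact hcont.integrableOn_Icc.mono_set Set.Ioc_subset_Icc_self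
    · refine (ae_restrict_iff' measurableSet_Ioc).2 (Filter.Eventually.of_forall fun t ht ↦ ?_)
      exact sub_nonneg.2 (gaussianPDFReal_sub_le hs ht.1.le)
    rw [← intervalIntegral.integral_of_le hc, intervalIntegral.integral_sub,
      intervalIntegral.integral_comp_sub_right, intervalIntegral.integral_comp_add_right]
    rotate_left
    · exact (hc₁ r).intervalIntegrable _ _
    · exact (hc₂ r).intervalIntegrable _ _
    have hmono : 0 ≤ (∫ x in (0 - r)..(c - r), gaussianPDFReal 0 v x) -
        ∫ x in (0 + r)..(c + r), gaussianPDFReal 0 v x := by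
      rw [← intervalIntegral.integral_comp_sub_right, ← intervalIntegral.integral_comp_add_right,
        ← intervalIntegral.integral_sub
          ((hc₁ r).intervalIntegrable _ _) ((hc₂ r).intervalIntegrable _ _)]
      exact intervalIntegral.integral_nonneg hc
        fun t ht ↦ sub_nonneg.2 (gaussianPDFReal_sub_le hs ht.1)
    rw [← ENNReal.ofReal_add _ hmono]
    · congr 1
      have e1 := intervalIntegral.integral_add_adjacent_intervals (hi (0 - r) (c - r))
        (hi (c - r) (c + r))
      have e2 := intervalIntegral.integral_add_adjacent_intervals (hi (0 - r) (0 + r))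
        (hi (0 + r) (c + r))
      linarith
    · exact intervalIntegral.integral_nonneg (by linarith) fun _ _ ↦ gaussianPDFReal_nonneg _ _ _

lemma gaussianReal_sq_sub_abs_le (v : ℝ≥0) (c y : ℝ) :
    gaussianReal 0 v {z | (z - |c|) ^ 2 ≤ y} = gaussianReal 0 v {z | (z - c) ^ 2 ≤ y} := by
  rcases abs_choice c with h | h
  · rw [h]
  · have := gaussianReal_map_neg (μ := 0) (v := v)
    rw [neg_zero] at this
    conv_lhs => rw [← this]
    rw [Measure.map_apply measurable_neg (measurableSet_le (by fun_prop) measurable_const)]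
    congr 1
    ext z
    simp only [Set.mem_preimage, Set.mem_ofPred_eq, h]
    rw [show (-z - -c) ^ 2 = (z - c) ^ 2 by ring]

/-- A one-dimensional instance of Anderson's inequality. -/
lemma gaussianReal_sq_sub_le_le (v : ℝ≥0) (c y : ℝ) :
    gaussianReal 0 v {z | (z - c) ^ 2 ≤ y} ≤ gaussianReal 0 v {z | (z - 0) ^ 2 ≤ y} := by
  rcases eq_or_ne v 0 with rfl | hv
  · rw [gaussianReal_zero_var, Measure.dirac_apply' _ (measurableSet_le (by fun_prop) measurable_const),
      Measure.dirac_apply' _ (measurableSet_le (by fun_prop) measurable_const)]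
    simp only [Set.indicator_apply, Set.mem_ofPred_eq]
    split_ifs with h₁ h₂
    · exact le_rfl
    · exact absurd (by nlinarith [sq_nonneg (0 - c)]) h₂
    all_goals simp
  · rw [← gaussianReal_sq_sub_abs_le, gaussianReal_sq_le_eq_add hv (abs_nonneg c)]
    exact le_self_add

lemma map_add_sq_Iic (ρ : Measure ℝ) [SFinite ρ] (v : ℝ≥0) (c y : ℝ) :
    ((ρ.prod (gaussianReal 0 v)).map fun p ↦ p.1 + (p.2 - c) ^ 2) (Set.Iic y) =
      ∫⁻ r, gaussianReal 0 v {z | (z - c) ^ 2 ≤ y - r} ∂ρ := by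
  rw [Measure.map_apply (by fun_prop) measurableSet_Iic,
    Measure.prod_apply (measurableSet_Iic.preimage (by fun_prop))]
  refine lintegral_congr fun r ↦ congrArg _ ?_
  ext z
  simp only [Set.mem_preimage, Set.mem_Iic, Set.mem_ofPred_eq]
  constructor <;> intro h <;> linarith

lemma map_add_sq_sub_Iic_le (ρ : Measure ℝ) [SFinite ρ] (v : ℝ≥0) (c y : ℝ) :
    ((ρ.prod (gaussianReal 0 v)).map fun p ↦ p.1 + (p.2 - c) ^ 2) (Set.Iic y) ≤
      ((ρ.prod (gaussianReal 0 v)).map fun p ↦ p.1 + (p.2 - 0) ^ 2) (Set.Iic y) := by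
  rw [map_add_sq_Iic, map_add_sq_Iic]
  exact lintegral_mono fun r ↦ gaussianReal_sq_sub_le_le v c (y - r)

lemma measurable_exponentialPDF (r : ℝ) : Measurable (exponentialPDF r) :=
  (measurable_gammaPDFReal _ _).ennreal_ofReal

lemma setLIntegral_two_mul {c : ℝ} (hc : 0 ≤ c) :
    ∫⁻ t in Set.Ioc 0 c, ENNReal.ofReal (2 * t) = ENNReal.ofReal (c ^ 2) := by
  rw [← ofReal_integral_eq_lintegral_ofReal, ← intervalIntegral.integral_of_le hc,
    intervalIntegral.integral_const_mul, integral_id]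
  · congr 1; ring
  · exact ((by fun_prop : Continuous fun t : ℝ ↦ 2 * t).integrableOn_Icc).mono_set
      Set.Ioc_subset_Icc_self
  · refine (ae_restrict_iff' measurableSet_Ioc).2 (Filter.Eventually.of_forall fun t ht ↦ ?_)
    have := ht.1
    simp only [Pi.zero_apply]
    positivity

lemma map_add_sq_Iic_le_add {ρ : Measure ℝ} [SFinite ρ] {v : ℝ≥0} {M : ℝ≥0∞}
    (hM : ∀ t, (ρ.prod (gaussianReal 0 v)).map (fun p ↦ p.1 + (p.2 - t) ^ 2) ≤ M • volume)
    (c y : ℝ) :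
    ((ρ.prod (gaussianReal 0 v)).map fun p ↦ p.1 + (p.2 - 0) ^ 2) (Set.Iic y) ≤
      ((ρ.prod (gaussianReal 0 v)).map fun p ↦ p.1 + (p.2 - c) ^ 2) (Set.Iic y) +
        M * ENNReal.ofReal (c ^ 2) := by
  rcases eq_or_ne v 0 with rfl | hv
  -- A degenerate coordinate only translates the law by c², so the density bound on an interval of
  -- that length suffices.
  · have h1 : ((ρ.prod (gaussianReal 0 0)).map fun p ↦ p.1 + (p.2 - c) ^ 2) (Set.Iic y) =
        ((ρ.prod (gaussianReal 0 0)).map fun p ↦ p.1 + (p.2 - 0) ^ 2) (Set.Iic (y - c ^ 2)) := by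
      rw [map_add_sq_Iic, map_add_sq_Iic]
      refine lintegral_congr fun r ↦ ?_
      rw [gaussianReal_zero_var,
        Measure.dirac_apply' _ (measurableSet_le (by fun_prop) measurable_const),
        Measure.dirac_apply' _ (measurableSet_le (by fun_prop) measurable_const)]
      simp only [Set.indicator_apply, Set.mem_ofPred_eq]
      congr 1
      rw [eq_iff_iff]
      constructor <;> intro h <;> linarith
    have h2 : Set.Iic y ⊆ Set.Iic (y - c ^ 2) ∪ Set.Ioc (y - c ^ 2) y := by
      intro z hz
      rcases le_or_gt z (y - c ^ 2) with h | h
      exacts [Or.inl h, Or.inr ⟨h, hz⟩]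
    rw [h1]
    refine (measure_mono h2).trans ((measure_union_le _ _).trans ?_)
    gcongr
    refine (hM 0 _).trans ?_
    rw [Measure.smul_apply, Real.volume_Ioc, smul_eq_mul, sub_sub_cancel]
  · rw [map_add_sq_Iic, map_add_sq_Iic]
    have he := measurable_exponentialPDF (1 / (2 * v))
    have hmeas : Measurable fun q : ℝ × ℝ ↦ ENNReal.ofReal (2 * q.2) *
        ∫⁻ z, exponentialPDF (1 / (2 * v)) (y - q.1 - (z - q.2) ^ 2) ∂(gaussianReal 0 v) := by
      refine Measurable.mul (by fun_prop) ?_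
      refine Measurable.lintegral_prod_right'
        (f := fun q : (ℝ × ℝ) × ℝ ↦
          exponentialPDF (1 / (2 * v)) (y - q.1.1 - (q.2 - q.1.2) ^ 2)) ?_
      exact he.comp (by fun_prop)
    calc ∫⁻ r, gaussianReal 0 v {z | (z - 0) ^ 2 ≤ y - r} ∂ρ
      _ = ∫⁻ r, (gaussianReal 0 v {z | (z - c) ^ 2 ≤ y - r} +
          ∫⁻ t in Set.Ioc 0 |c|, ENNReal.ofReal (2 * t) *
            ∫⁻ z, exponentialPDF (1 / (2 * v)) (y - r - (z - t) ^ 2) ∂(gaussianReal 0 v)) ∂ρ :=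
        lintegral_congr fun r ↦ by
          rw [gaussianReal_sq_le_eq_add hv (abs_nonneg c), gaussianReal_sq_sub_abs_le]
      _ = ∫⁻ r, gaussianReal 0 v {z | (z - c) ^ 2 ≤ y - r} ∂ρ +
          ∫⁻ r, (∫⁻ t in Set.Ioc 0 |c|, ENNReal.ofReal (2 * t) *
            ∫⁻ z, exponentialPDF (1 / (2 * v)) (y - r - (z - t) ^ 2) ∂(gaussianReal 0 v)) ∂ρ :=
        lintegral_add_right _
          (hmeas.lintegral_prod_right' (ν := volume.restrict (Set.Ioc 0 |c|)))
      _ ≤ _ := by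
        gcongr
        -- After Tonelli the inner integral, at fixed t, is the density at y of a law bounded by M •
        -- volume convolved with an exponential one, hence at most M.
        rw [lintegral_lintegral_swap hmeas.aemeasurable]
        rw [← sq_abs c, ← setLIntegral_two_mul (abs_nonneg c), ← lintegral_const_mul _ (by fun_prop)]
        refine lintegral_mono fun t ↦ ?_
        simp only
        rw [lintegral_const_mul' _ _ ENNReal.ofReal_ne_top, mul_comm]
        gcongr
        calc ∫⁻ r, ∫⁻ z, exponentialPDF (1 / (2 * v)) (y - r - (z - t) ^ 2) ∂(gaussianReal 0 v) ∂ρ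
          _ = ∫⁻ s, exponentialPDF (1 / (2 * v)) (y - s)
              ∂((ρ.prod (gaussianReal 0 v)).map fun p ↦ p.1 + (p.2 - t) ^ 2) := by
            have he' : Measurable fun s ↦ exponentialPDF (1 / (2 * v)) (y - s) :=
              he.comp (by fun_prop)
            have hp : Measurable fun p : ℝ × ℝ ↦ p.1 + (p.2 - t) ^ 2 := by fun_prop
            rw [lintegral_map he' hp, lintegral_prod
              (fun p : ℝ × ℝ ↦ exponentialPDF (1 / (2 * v)) (y - (p.1 + (p.2 - t) ^ 2)))
              (he'.comp hp).aemeasurable]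
            simp only [sub_sub]
          _ ≤ ∫⁻ s, exponentialPDF (1 / (2 * v)) (y - s) ∂(M • volume) :=
            lintegral_mono' (hM t) le_rfl
          _ = M := by
            rw [lintegral_smul_measure, lintegral_sub_left_eq_self,
              lintegral_exponentialPDF_eq_one (by positivity), smul_eq_mul, mul_one]

/-! ### Shifts and scalings of finite-dimensional Gaussian vectors -/

variable {ι : Type*} [Fintype ι]

/-- The centred Gaussian measure on `ι → ℝ` with independent coordinates of variances `v i`. -/
abbrev gaussianPi (v : ι → ℝ≥0) : Measure (ι → ℝ) := Measure.pi fun i ↦ gaussianReal 0 (v i)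

/-- The squared Euclidean distance of `x` to `b`. -/
def sqDist (b x : ι → ℝ) : ℝ := ∑ i, (x i - b i) ^ 2

@[fun_prop]
lemma measurable_sqDist (b : ι → ℝ) : Measurable (sqDist b) := by
  unfold sqDist; fun_prop

lemma map_sqDist_update [DecidableEq ι] (v : ι → ℝ≥0) (b : ι → ℝ) (k : ι) :
    ∃ ρ : Measure ℝ, IsProbabilityMeasure ρ ∧ ∀ t,
      (gaussianPi v).map (sqDist (Function.update b k t)) =
        (ρ.prod (gaussianReal 0 (v k))).map fun p ↦ p.1 + (p.2 - t) ^ 2 := by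
  -- Coordinate k is left unsquared and unshifted, so a single factorization of the joint law of
  -- (rest, x_k) serves all t.
  let f : ι → ℝ → ℝ := fun i z ↦ if i = k then z else (z - b i) ^ 2
  have hf (i : ι) : Measurable (f i) := by
    by_cases h : i = k <;> simp only [f, h, if_true, if_false] <;> fun_prop
  have hind : iIndepFun (fun i (x : ι → ℝ) ↦ f i (x i)) (gaussianPi v) :=
    iIndepFun_pi fun i ↦ (hf i).aemeasurable
  have h2 := hind.indepFun_finsetSum_of_notMem (fun i ↦ (hf i).comp (measurable_pi_apply i))
    (Finset.notMem_erase k Finset.univ)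
  set R : (ι → ℝ) → ℝ := ∑ j ∈ Finset.univ.erase k, fun x ↦ f j (x j) with hR
  have hkm (j : ι) : Measurable fun x : ι → ℝ ↦ f j (x j) := (hf j).comp (measurable_pi_apply j)
  have hRm : Measurable R := by
    convert Finset.measurable_sum (Finset.univ.erase k) fun j _ ↦ hkm j using 1
    ext x
    simp [hR]
  have h3 := (indepFun_iff_map_prod_eq_prod_map_map hRm.aemeasurable (hkm k).aemeasurable).1 h2
  refine ⟨(gaussianPi v).map R, Measure.isProbabilityMeasure_map hRm.aemeasurable, fun t ↦ ?_⟩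
  have h4 : (gaussianPi v).map (fun x ↦ f k (x k)) = gaussianReal 0 (v k) := by
    simp only [f, if_true]
    exact (measurePreserving_eval (fun i ↦ gaussianReal 0 (v i)) k).map_eq
  rw [← h4, ← h3, Measure.map_map (by fun_prop)
    (hRm.prodMk (hkm k))]
  congr 1
  ext x
  simp only [sqDist, Function.comp_apply, hR, Finset.sum_apply, f, if_true]
  rw [← Finset.sum_erase_add _ _ (Finset.mem_univ k), Function.update_self]
  congr 1
  refine Finset.sum_congr rfl fun j hj ↦ ?_
  rw [Function.update_of_ne (Finset.ne_of_mem_erase hj), if_neg (Finset.ne_of_mem_erase hj)]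

/-- Anderson's inequality for balls and Gaussian vectors with independent coordinates. -/
lemma map_sqDist_Iic_le (v : ι → ℝ≥0) (b : ι → ℝ) (y : ℝ) :
    (gaussianPi v).map (sqDist b) (Set.Iic y) ≤ (gaussianPi v).map (sqDist 0) (Set.Iic y) := by
  classical
  suffices h : ∀ s : Finset ι, (gaussianPi v).map (sqDist (s.piecewise b 0)) (Set.Iic y) ≤
      (gaussianPi v).map (sqDist 0) (Set.Iic y) by simpa using h Finset.univ
  intro s
  induction s using Finset.induction_on with
  | empty => simp
  | insert k s hk ih =>
    refine le_trans ?_ ih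
    obtain ⟨ρ, _, hρ⟩ := map_sqDist_update v (s.piecewise b 0) k
    have h0 : s.piecewise b 0 = Function.update (s.piecewise b 0) k 0 := by
      rw [eq_comm, Function.update_eq_self_iff, Finset.piecewise_eq_of_notMem _ _ _ hk]; rfl
    rw [Finset.piecewise_insert, hρ, h0, hρ]
    exact map_add_sq_sub_Iic_le _ _ _ _

/-- Coordinates of the shift are switched on one at a time and the costs add up. The density bound
is needed for all b because the intermediate shifts vary. -/
lemma map_sqDist_zero_Iic_le_add {v : ι → ℝ≥0} {M : ℝ≥0∞}
    (hM : ∀ b, (gaussianPi v).map (sqDist b) ≤ M • volume) (b : ι → ℝ) (y : ℝ) :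
    (gaussianPi v).map (sqDist 0) (Set.Iic y) ≤
      (gaussianPi v).map (sqDist b) (Set.Iic y) + M * ∑ i, ENNReal.ofReal (b i ^ 2) := by
  classical
  suffices h : ∀ s : Finset ι, (gaussianPi v).map (sqDist 0) (Set.Iic y) ≤
      (gaussianPi v).map (sqDist (s.piecewise b 0)) (Set.Iic y) +
        M * ∑ i ∈ s, ENNReal.ofReal (b i ^ 2) by simpa using h Finset.univ
  intro s
  induction s using Finset.induction_on with
  | empty => simp
  | insert k s hk ih =>
    refine ih.trans ?_
    obtain ⟨ρ, _, hρ⟩ := map_sqDist_update v (s.piecewise b 0) k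
    have h0 : s.piecewise b 0 = Function.update (s.piecewise b 0) k 0 := by
      rw [eq_comm, Function.update_eq_self_iff, Finset.piecewise_eq_of_notMem _ _ _ hk]; rfl
    rw [Finset.sum_insert hk, mul_add, ← add_assoc]
    gcongr
    rw [Finset.piecewise_insert, hρ]
    nth_rw 1 [h0]
    rw [hρ]
    exact map_add_sq_Iic_le_add (fun t ↦ hρ t ▸ hM _) _ _

lemma gaussianPi_add (v w : ι → ℝ≥0) :
    gaussianPi (v + w) = ((gaussianPi v).prod (gaussianPi w)).map fun p ↦ p.1 + p.2 := by
  have h1 (i : ι) : gaussianReal 0 ((v + w) i) =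
      ((gaussianReal 0 (v i)).prod (gaussianReal 0 (w i))).map fun p ↦ p.1 + p.2 := by
    have := gaussianReal_conv_gaussianReal (m₁ := 0) (m₂ := 0) (v₁ := v i) (v₂ := w i)
    rw [add_zero] at this
    exact this.symm
  rw [gaussianPi, funext h1]
  rw [← Measure.pi_map_pi (f := fun _ (p : ℝ × ℝ) ↦ p.1 + p.2) (fun i ↦ by fun_prop),
    ← (measurePreserving_arrowProdEquivProdArrow ℝ ℝ ι (fun i ↦ gaussianReal 0 (v i))
      (fun i ↦ gaussianReal 0 (w i))).map_eq,
    Measure.map_map (by fun_prop) (MeasurableEquiv.measurable _)]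
  rfl

lemma lintegral_sq_gaussianReal (v : ℝ≥0) :
    ∫⁻ z, ENNReal.ofReal (z ^ 2) ∂(gaussianReal 0 v) = v := by
  have h := variance_id_gaussianReal (μ := 0) (v := v)
  rw [variance_eq_integral aemeasurable_id] at h
  simp only [id_eq, integral_id_gaussianReal, sub_zero] at h
  rw [← ofReal_integral_eq_lintegral_ofReal, h, ENNReal.ofReal_coe_nnreal]
  · exact (memLp_id_gaussianReal (μ := 0) (v := v) 2).integrable_sq
  · exact Filter.Eventually.of_forall fun z ↦ sq_nonneg z

lemma map_sqDist_add_Iic (v w : ι → ℝ≥0) (y : ℝ) :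
    (gaussianPi (v + w)).map (sqDist 0) (Set.Iic y) =
      ∫⁻ z, (gaussianPi v).map (sqDist (-z)) (Set.Iic y) ∂(gaussianPi w) := by
  have hm : Measurable fun p : (ι → ℝ) × (ι → ℝ) ↦ p.1 + p.2 := by fun_prop
  rw [gaussianPi_add, Measure.map_map (by fun_prop) hm,
    Measure.map_apply ((measurable_sqDist 0).comp hm) measurableSet_Iic,
    Measure.prod_apply_symm (measurableSet_Iic.preimage ((measurable_sqDist 0).comp hm))]
  refine lintegral_congr fun z ↦ ?_
  rw [Measure.map_apply (by fun_prop) measurableSet_Iic]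
  congr 1
  ext x
  simp [sqDist]

/-- Extra variance is an independent random shift; Anderson's inequality applies conditionally on
it. -/
lemma map_sqDist_add_Iic_le (v w : ι → ℝ≥0) (y : ℝ) :
    (gaussianPi (v + w)).map (sqDist 0) (Set.Iic y) ≤
      (gaussianPi v).map (sqDist 0) (Set.Iic y) := by
  rw [map_sqDist_add_Iic]
  refine (lintegral_mono fun z ↦ map_sqDist_Iic_le v (-z) y).trans ?_
  simp

lemma map_sqDist_Iic_le_add {v : ι → ℝ≥0} {M : ℝ≥0∞}
    (hM : ∀ b, (gaussianPi v).map (sqDist b) ≤ M • volume) (w : ι → ℝ≥0) (y : ℝ) :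
    (gaussianPi v).map (sqDist 0) (Set.Iic y) ≤
      (gaussianPi (v + w)).map (sqDist 0) (Set.Iic y) + M * ∑ i, (w i : ℝ≥0∞) := by
  have h1 : ∫⁻ z : ι → ℝ, M * ∑ i, ENNReal.ofReal ((-z) i ^ 2) ∂(gaussianPi w) =
      M * ∑ i, (w i : ℝ≥0∞) := by
    rw [lintegral_const_mul _ (by fun_prop), lintegral_finsetSum _ (fun i _ ↦ by fun_prop)]
    congr 1
    refine Finset.sum_congr rfl fun i _ ↦ ?_
    simp only [Pi.neg_apply, neg_sq]
    rw [← lintegral_sq_gaussianReal (w i),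
      ← (measurePreserving_eval (fun i ↦ gaussianReal 0 (w i)) i).lintegral_comp (by fun_prop)]
  rw [map_sqDist_add_Iic, ← h1, ← lintegral_add_right _ (by fun_prop)]
  calc (gaussianPi v).map (sqDist 0) (Set.Iic y)
    _ = ∫⁻ _, (gaussianPi v).map (sqDist 0) (Set.Iic y) ∂(gaussianPi w) := by simp
    _ ≤ _ := lintegral_mono fun z ↦ map_sqDist_zero_Iic_le_add hM (-z) y

end GaussianComparison

namespace GaussianComparison

/-! ### Bounded densities -/

/-- A multiple of Lebesgue measure is a Stieltjes measure, and its outer measure is the largest one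
below the length function; so half-open intervals decide the inequality. -/
lemma le_smul_volume_of_Ioc {μ : Measure ℝ} {M : ℝ≥0}
    (h : ∀ p q : ℝ, p ≤ q → μ (Set.Ioc p q) ≤ M * ENNReal.ofReal (q - p)) :
    μ ≤ (M : ℝ≥0∞) • volume := by
  have h0 : (M : ℝ≥0∞) • (volume : Measure ℝ) = (M • StieltjesFunction.id).measure := by
    rw [StieltjesFunction.measure_smul, Real.volume_eq_stieltjes_id]
    rfl
  rw [h0, ← Measure.toOuterMeasure_le, StieltjesFunction.measure_def]
  change μ.toOuterMeasure ≤ (M • StieltjesFunction.id).outer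
  unfold StieltjesFunction.outer
  refine OuterMeasure.le_ofFunction.2 fun s ↦ ?_
  rw [StieltjesFunction.length, if_neg (by simp)]
  refine le_iInf fun a ↦ le_iInf fun b ↦ le_iInf fun hs ↦ ?_
  have hs' : s ⊆ Set.Ioc a b := by
    have h0 : (botSet : Set ℝ) = ∅ := Set.eq_empty_of_forall_notMem fun x ↦ not_isBot x
    rwa [h0, Set.sdiff_empty] at hs
  rcases le_total a b with hab | hab
  · refine (measure_mono hs').trans ((h a b hab).trans_eq ?_)
    rw [← ENNReal.ofReal_coe_nnreal, ← ENNReal.ofReal_mul M.coe_nonneg]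
    congr 1
    exact mul_sub _ _ _
  · rw [Set.Ioc_eq_empty (not_lt.2 hab), Set.subset_empty_iff] at hs'
    simp [hs']

lemma gaussianReal_le_smul_volume {v : ℝ≥0} (hv : v ≠ 0) :
    gaussianReal 0 v ≤ ENNReal.ofReal (√(2 * Real.pi * v))⁻¹ • volume := by
  rw [gaussianReal_of_var_ne_zero _ hv, ← withDensity_const]
  refine withDensity_mono (Filter.Eventually.of_forall fun x ↦ ?_)
  refine ENNReal.ofReal_le_ofReal ?_
  rw [gaussianPDFReal]
  refine mul_le_of_le_one_right (by positivity) (Real.exp_le_one_iff.2 ?_)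
  rw [neg_div]
  exact neg_nonpos.2 (by positivity)

/-- A version of Esseen's concentration inequality. -/
lemma measure_Icc_le_lintegral_charFun (μ : Measure ℝ) [IsProbabilityMeasure μ] (y : ℝ) {h : ℝ}
    (hh : 0 < h) :
    μ (Set.Icc (y - h) (y + h)) ≤
      ENNReal.ofReal (Real.exp (1 / 2) * (h / √(2 * Real.pi))) * ∫⁻ t, ‖charFun μ t‖ₑ := by
  -- The indicator of [y − h, y + h] is at most e^(1/2)·exp(−(s − y)²/(2h²)), and this exponential
  -- is the characteristic function of N(0, h⁻²) at s − y. Fubini moves the integral onto `charFun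
  -- μ`, and the density of N(0, h⁻²) is at most h/√(2π).
  set v : ℝ≥0 := ⟨(h ^ 2)⁻¹, by positivity⟩
  have hvr : (v : ℝ) = (h ^ 2)⁻¹ := rfl
  have hv0 : v ≠ 0 := by
    rw [← NNReal.coe_ne_zero, hvr]; positivity
  have hker (s : ℝ) : (Real.exp (-(v * (s - y) ^ 2 / 2)) : ℂ) =
      ∫ z, Complex.exp (z * (s - y) * Complex.I) ∂(gaussianReal 0 v) := by
    have := charFun_gaussianReal (μ := 0) (v := v) (s - y)
    rw [charFun_apply_real] at this
    push_cast at this ⊢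
    simp only [mul_zero, zero_mul, zero_sub] at this
    rw [← this]
    congr 1
    ext z
    congr 2
    ring
  have h_int : Integrable (Function.uncurry fun s z : ℝ ↦
      Complex.exp (z * (s - y) * Complex.I)) (μ.prod (gaussianReal 0 v)) := by
    refine Integrable.of_bound (C := 1) ?_ (Filter.Eventually.of_forall fun p ↦ ?_)
    · exact Continuous.aestronglyMeasurable (by simp only [Function.uncurry_def]; fun_prop)
    · simp only [Function.uncurry]
      rw [← Complex.ofReal_sub, ← Complex.ofReal_mul, Complex.norm_exp_ofReal_mul_I]
  have hswap : (∫ s, (Real.exp (-(v * (s - y) ^ 2 / 2)) : ℂ) ∂μ) =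
      ∫ z, Complex.exp (-(z * y * Complex.I)) * charFun μ z ∂(gaussianReal 0 v) := by
    simp_rw [hker]
    rw [integral_integral_swap h_int]
    refine integral_congr_ae (Filter.Eventually.of_forall fun z ↦ ?_)
    simp only
    rw [charFun_apply_real, ← integral_const_mul]
    refine integral_congr_ae (Filter.Eventually.of_forall fun s ↦ ?_)
    simp only
    rw [← Complex.exp_add]
    congr 1
    ring
  have hcont : Continuous fun s : ℝ ↦ Real.exp (-(v * (s - y) ^ 2 / 2)) := by fun_prop
  calc μ (Set.Icc (y - h) (y + h))
    _ = ∫⁻ s in Set.Icc (y - h) (y + h), 1 ∂μ := by simp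
    _ ≤ ∫⁻ s in Set.Icc (y - h) (y + h), ENNReal.ofReal (Real.exp (1 / 2)) *
          ENNReal.ofReal (Real.exp (-(v * (s - y) ^ 2 / 2))) ∂μ := by
      refine setLIntegral_mono' measurableSet_Icc fun s hs ↦ ?_
      rw [← ENNReal.ofReal_mul (by positivity), ← Real.exp_add, ← ENNReal.ofReal_one]
      refine ENNReal.ofReal_le_ofReal (Real.one_le_exp ?_)
      have h1 : (s - y) ^ 2 ≤ h ^ 2 := sq_le_sq' (by linarith [hs.1]) (by linarith [hs.2])
      have h2 : v * (s - y) ^ 2 ≤ 1 := by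
        rw [hvr, inv_mul_le_iff₀ (by positivity)]; linarith
      linarith
    _ ≤ ∫⁻ s, ENNReal.ofReal (Real.exp (1 / 2)) *
          ENNReal.ofReal (Real.exp (-(v * (s - y) ^ 2 / 2))) ∂μ := setLIntegral_le_lintegral _ _
    _ = ENNReal.ofReal (Real.exp (1 / 2)) *
          ‖∫ s, (Real.exp (-(v * (s - y) ^ 2 / 2)) : ℂ) ∂μ‖ₑ := by
      rw [lintegral_const_mul' _ _ ENNReal.ofReal_ne_top, ← ofReal_integral_eq_lintegral_ofReal]
      · rw [integral_complex_ofReal, ← ofReal_norm, Complex.norm_real, Real.norm_of_nonneg]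
        exact integral_nonneg fun s ↦ (Real.exp_pos _).le
      · refine Integrable.of_bound (C := 1) hcont.aestronglyMeasurable
          (Filter.Eventually.of_forall fun s ↦ ?_)
        rw [Real.norm_of_nonneg (Real.exp_pos _).le]
        exact Real.exp_le_one_iff.2 (neg_nonpos.2 (by positivity))
      · exact Filter.Eventually.of_forall fun s ↦ (Real.exp_pos _).le
    _ ≤ ENNReal.ofReal (Real.exp (1 / 2)) * ∫⁻ z, ‖charFun μ z‖ₑ ∂(gaussianReal 0 v) := by
      rw [hswap]
      gcongr
      refine (enorm_integral_le_lintegral_enorm _).trans (lintegral_mono fun z ↦ ?_)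
      rw [enorm_mul, ← ofReal_norm (Complex.exp _), ← Complex.ofReal_mul,
        ← neg_mul, ← Complex.ofReal_neg, Complex.norm_exp_ofReal_mul_I, ENNReal.ofReal_one, one_mul]
    _ ≤ ENNReal.ofReal (Real.exp (1 / 2)) * ∫⁻ z, ‖charFun μ z‖ₑ
          ∂(ENNReal.ofReal (√(2 * Real.pi * v))⁻¹ • volume) := by
      gcongr
      exact gaussianReal_le_smul_volume hv0
    _ = _ := by
      rw [lintegral_smul_measure, smul_eq_mul, ← mul_assoc, ← ENNReal.ofReal_mul (by positivity)]
      congr 3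
      rw [hvr, Real.sqrt_mul (by positivity), Real.sqrt_inv, Real.sqrt_sq hh.le, mul_inv, inv_inv]
      ring

/-- A probability measure with integrable characteristic function has bounded density. -/
lemma le_smul_volume_of_charFun {μ : Measure ℝ} [IsProbabilityMeasure μ] {M : ℝ≥0}
    (h : ∫⁻ t, ‖charFun μ t‖ₑ ≤ M) : μ ≤ (M : ℝ≥0∞) • volume := by
  refine le_smul_volume_of_Ioc fun p q hpq ↦ ?_
  rcases hpq.eq_or_lt with rfl | hlt
  · simp
  have h1 := measure_Icc_le_lintegral_charFun μ ((p + q) / 2) (h := (q - p) / 2) (by linarith)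
  rw [show (p + q) / 2 - (q - p) / 2 = p by ring, show (p + q) / 2 + (q - p) / 2 = q by ring] at h1
  refine (measure_mono Set.Ioc_subset_Icc_self).trans (h1.trans ?_)
  rw [mul_comm]
  refine mul_le_mul' h (ENNReal.ofReal_le_ofReal ?_)
  have e1 : Real.exp (1 / 2) ≤ 2 := by
    rw [← Real.le_log_iff_exp_le (by norm_num)]
    linarith [Real.log_two_gt_d9]
  have e2 : 1 ≤ √(2 * Real.pi) := by
    rw [Real.one_le_sqrt]; linarith [Real.pi_gt_three]
  calc Real.exp (1 / 2) * ((q - p) / 2 / √(2 * Real.pi))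
    _ ≤ 2 * ((q - p) / 2 / 1) := by gcongr
    _ = q - p := by ring

/-! ### Characteristic functions of Gaussian quadratic forms -/

/-- This is an explicit Gaussian integral with quadratic coefficient B = −1/(2v) + it. The shift
contributes a factor with exponent of real part (tb)²·Re(1/B) ≤ 0, so it only decreases the modulus.
-/
lemma norm_integral_cexp_sq_sub_le (v : ℝ≥0) (b t : ℝ) :
    ‖∫ z, Complex.exp (t * ((z - b) ^ 2 : ℝ) * Complex.I) ∂(gaussianReal 0 v)‖ ≤
      (1 + 4 * (v : ℝ) ^ 2 * t ^ 2) ^ (-(1 / 4) : ℝ) := by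
  rcases eq_or_ne v 0 with rfl | hv
  · rw [gaussianReal_zero_var, integral_dirac, ← Complex.ofReal_mul, Complex.norm_exp_ofReal_mul_I]
    simp
  have hv' : (0 : ℝ) < v := by positivity
  set B : ℂ := -(1 / (2 * v) : ℝ) + t * Complex.I with hB
  have hBre : B.re = -(1 / (2 * v)) := by simp [hB]
  have hBim : B.im = t := by simp [hB]
  have hBneg : B.re < 0 := by rw [hBre]; exact neg_neg_of_pos (by positivity)
  set K : ℝ := (√(2 * Real.pi * v))⁻¹ with hK
  have h1 (z : ℝ) : gaussianPDFReal 0 v z • Complex.exp (t * ((z - b) ^ 2 : ℝ) * Complex.I) =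
      K * Complex.exp (B * z ^ 2 + (-2 * t * b * Complex.I) * z + t * b ^ 2 * Complex.I) := by
    rw [gaussianPDFReal, Complex.real_smul, Complex.ofReal_mul, Complex.ofReal_exp, mul_assoc,
      ← Complex.exp_add]
    congr 2
    simp only [hB]
    push_cast
    have : (v : ℂ) ≠ 0 := by exact_mod_cast hv'.ne'
    field_simp
    ring
  have hw : 0 < 1 + 4 * (v : ℝ) ^ 2 * t ^ 2 := by positivity
  set w : ℝ := 1 + 4 * (v : ℝ) ^ 2 * t ^ 2
  have hnB : ‖B‖ = √w / (2 * v) := by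
    rw [Complex.norm_def, Complex.normSq_apply, hBre, hBim,
      show -(1 / (2 * (v : ℝ))) * -(1 / (2 * v)) + t * t = w / (2 * v) ^ 2 by
        simp only [w]; field_simp; ring,
      Real.sqrt_div hw.le, Real.sqrt_sq (by positivity)]
  rw [integral_gaussianReal_eq_integral_smul hv]
  simp_rw [h1]
  rw [integral_const_mul, integral_cexp_quadratic hBneg, norm_mul, norm_mul, Complex.norm_real,
    Real.norm_of_nonneg (by positivity)]
  have h2 : ‖((Real.pi : ℂ) / -B) ^ (1 / 2 : ℂ)‖ = √(2 * Real.pi * v) * w ^ (-(1 / 4) : ℝ) := by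
    rw [show (1 / 2 : ℂ) = ((1 / 2 : ℝ) : ℂ) by push_cast; rfl, Complex.norm_cpow_real, norm_div,
      norm_neg, hnB, Complex.norm_real, Real.norm_of_nonneg Real.pi_pos.le,
      show Real.pi / (√w / (2 * v)) = (2 * Real.pi * v) * (√w)⁻¹ by
        have := Real.sqrt_ne_zero'.2 hw
        field_simp,
      Real.mul_rpow (by positivity) (by positivity), ← Real.sqrt_eq_rpow]
    congr 1
    rw [Real.sqrt_eq_rpow, ← Real.rpow_neg hw.le, ← Real.rpow_mul hw.le]
    norm_num
  have h3 : ‖Complex.exp (t * b ^ 2 * Complex.I - (-2 * t * b * Complex.I) ^ 2 / (4 * B))‖ ≤ 1 := by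
    rw [Complex.norm_exp, Real.exp_le_one_iff]
    have : (t * b ^ 2 * Complex.I - (-2 * t * b * Complex.I) ^ 2 / (4 * B) : ℂ) =
        ((t * b ^ 2 : ℝ) : ℂ) * Complex.I + ((t * b) ^ 2 : ℝ) * B⁻¹ := by
      clear_value B
      rw [mul_pow, Complex.I_sq, div_eq_mul_inv, mul_inv]
      push_cast
      ring
    rw [this, Complex.add_re, Complex.re_ofReal_mul, Complex.re_ofReal_mul, Complex.I_re, mul_zero,
      zero_add, Complex.inv_re]
    exact mul_nonpos_of_nonneg_of_nonpos (by positivity)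
      (div_nonpos_of_nonpos_of_nonneg hBneg.le (Complex.normSq_nonneg _))
  rw [h2]
  calc K * (√(2 * Real.pi * v) * w ^ (-(1 / 4) : ℝ) * _)
    _ ≤ K * (√(2 * Real.pi * v) * w ^ (-(1 / 4) : ℝ) * 1) := by gcongr
    _ = w ^ (-(1 / 4) : ℝ) := by
      have : √(2 * Real.pi * v) ≠ 0 := Real.sqrt_ne_zero'.2 (by positivity)
      rw [hK]
      field_simp

variable {ι : Type*} [Fintype ι]

lemma norm_charFun_map_sqDist_le (v : ι → ℝ≥0) (b : ι → ℝ) (t : ℝ) :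
    ‖charFun ((gaussianPi v).map (sqDist b)) t‖ ≤
      ∏ i, (1 + 4 * (v i : ℝ) ^ 2 * t ^ 2) ^ (-(1 / 4) : ℝ) := by
  rw [charFun_apply_real, integral_map (by fun_prop)
    (Continuous.aestronglyMeasurable (by fun_prop))]
  have h (x : ι → ℝ) : Complex.exp (t * sqDist b x * Complex.I) =
      ∏ i, Complex.exp (t * ((x i - b i) ^ 2 : ℝ) * Complex.I) := by
    rw [← Complex.exp_sum, sqDist, Complex.ofReal_sum, Finset.mul_sum, Finset.sum_mul]
  simp_rw [h]
  rw [integral_fintype_prod_eq_prod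
    (f := fun i z ↦ Complex.exp (t * ((z - b i) ^ 2 : ℝ) * Complex.I)), norm_prod]
  exact Finset.prod_le_prod (fun _ _ ↦ norm_nonneg _)
    fun i _ ↦ norm_integral_cexp_sq_sub_le (v i) (b i) t

end GaussianComparison

namespace GaussianComparison

/-! ### Density bounds for weighted sums of squares -/

variable {ι : Type*}

/-- Bernoulli's inequality with exponent 3vᵢ²/L ≤ 1 gives (1 + x)^(3vᵢ²/L) ≤ 1 + 4vᵢ²t² for x =
4Lt²/3. The exponents then add up to at least (3/4)·(5/6) = 5/8, still above the 1/2 needed for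
integrability; the factor 5/6 leaves room for truncating the spectrum. -/
lemma prod_rpow_le {v : ι → ℝ≥0} {s : Finset ι} {L : ℝ} (hL : 0 < L)
    (h3 : ∀ i ∈ s, 3 * (v i : ℝ) ^ 2 ≤ L) (hsum : 5 / 6 * L ≤ ∑ i ∈ s, (v i : ℝ) ^ 2) (t : ℝ) :
    ∏ i ∈ s, (1 + 4 * (v i : ℝ) ^ 2 * t ^ 2) ^ (-(1 / 4) : ℝ) ≤
      (1 + (√(4 * L / 3) * t) ^ 2) ^ (-(5 / 8) : ℝ) := by
  set x : ℝ := (√(4 * L / 3) * t) ^ 2 with hx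
  have hx0 : 0 ≤ x := by positivity
  have hx' : x = 4 * L / 3 * t ^ 2 := by rw [hx, mul_pow, Real.sq_sqrt (by positivity)]
  have hpos : 0 < 1 + x := by positivity
  calc ∏ i ∈ s, (1 + 4 * (v i : ℝ) ^ 2 * t ^ 2) ^ (-(1 / 4) : ℝ)
    _ ≤ ∏ i ∈ s, (1 + x) ^ (3 * (v i : ℝ) ^ 2 / L * (-(1 / 4))) := by
      refine Finset.prod_le_prod (fun i _ ↦ by positivity) fun i hi ↦ ?_
      rw [Real.rpow_mul hpos.le]
      refine Real.rpow_le_rpow_of_nonpos (by positivity) ?_ (by norm_num)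
      refine (rpow_one_add_le_one_add_mul_self (by linarith) (by positivity)
        ((div_le_one hL).2 (h3 i hi))).trans_eq ?_
      rw [hx']
      field_simp
    _ = (1 + x) ^ (∑ i ∈ s, 3 * (v i : ℝ) ^ 2 / L * (-(1 / 4))) :=
      (Real.rpow_sum_of_pos hpos _ _).symm
    _ ≤ (1 + x) ^ (-(5 / 8) : ℝ) := by
      refine Real.rpow_le_rpow_of_exponent_le (by linarith) ?_
      rw [← Finset.sum_mul, ← Finset.sum_div, ← Finset.mul_sum]
      have : 5 / 2 ≤ 3 * ∑ i ∈ s, (v i : ℝ) ^ 2 / L := by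
        rw [← Finset.sum_div, ← mul_div_assoc, le_div_iff₀ hL]; linarith
      rw [← Finset.sum_div, ← mul_div_assoc] at this
      linarith

lemma lintegral_ofReal_comp_mul_left {f : ℝ → ℝ} (hf : Integrable f) (h0 : ∀ x, 0 ≤ f x) {α : ℝ}
    (hα : 0 < α) :
    ∫⁻ t, ENNReal.ofReal (f (α * t)) = ENNReal.ofReal ((∫ x, f x) / α) := by
  rw [← ofReal_integral_eq_lintegral_ofReal (hf.comp_mul_left' hα.ne')
    (Filter.Eventually.of_forall fun x ↦ h0 _), Measure.integral_comp_mul_left,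
    abs_of_pos (inv_pos.2 hα), smul_eq_mul, div_eq_inv_mul]

lemma integrable_rpow_one_add_sq :
    Integrable fun x : ℝ ↦ (1 + x ^ 2) ^ (-(5 / 8) : ℝ) := by
  have := integrable_rpow_neg_one_add_norm_sq (E := ℝ) (μ := volume) (r := 5 / 4) (by norm_num)
  convert this using 2 with x
  rw [Real.norm_eq_abs, sq_abs]
  norm_num

lemma integrable_abs_rpow_mul_rpow_one_add_sq :
    Integrable fun x : ℝ ↦ |x| ^ (-(1 / 2) : ℝ) * (1 + x ^ 2) ^ (-(5 / 8) : ℝ) := by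
  have h1 : IntervalIntegrable (fun x : ℝ ↦ |x| ^ (-(1 / 2) : ℝ)) volume 0 1 := by
    refine (intervalIntegral.intervalIntegrable_rpow' (r := -(1 / 2)) (by norm_num)).congr ?_
    intro x hx
    rw [Set.uIoc_of_le zero_le_one] at hx
    simp only [abs_of_pos hx.1]
  have h2 : IntervalIntegrable (fun x : ℝ ↦ |x| ^ (-(1 / 2) : ℝ)) volume (-1) 0 := by
    have := ((IntervalIntegrable.iff_comp_neg).1 h1).symm
    simpa using this
  have h3 : IntegrableOn (fun x : ℝ ↦ |x| ^ (-(1 / 2) : ℝ)) (Set.Ioc (-1) 1) := by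
    have := h2.trans h1
    rwa [intervalIntegrable_iff_integrableOn_Ioc_of_le (by norm_num)] at this
  refine Integrable.mono' ((h3.integrable_indicator measurableSet_Ioc).add
    integrable_rpow_one_add_sq) (Measurable.aestronglyMeasurable (by fun_prop))
    (Filter.Eventually.of_forall fun x ↦ ?_)
  rw [Real.norm_of_nonneg (by positivity), Pi.add_apply]
  by_cases hx : x ∈ Set.Ioc (-1 : ℝ) 1
  · rw [Set.indicator_of_mem hx]
    have : (1 + x ^ 2) ^ (-(5 / 8) : ℝ) ≤ 1 :=
      Real.rpow_le_one_of_one_le_of_nonpos (by nlinarith [sq_nonneg x]) (by norm_num)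
    have h4 : 0 ≤ |x| ^ (-(1 / 2) : ℝ) := by positivity
    have h5 : 0 ≤ (1 + x ^ 2) ^ (-(5 / 8) : ℝ) := by positivity
    nlinarith
  · rw [Set.indicator_of_notMem hx, zero_add]
    have hx1 : 1 ≤ |x| := by
      by_contra! h
      exact hx ⟨(abs_lt.1 h).1, (abs_lt.1 h).2.le⟩
    exact mul_le_of_le_one_left (by positivity)
      (Real.rpow_le_one_of_one_le_of_nonpos hx1 (by norm_num))

variable [Fintype ι]

instance (v : ι → ℝ≥0) (b : ι → ℝ) :
    IsProbabilityMeasure ((gaussianPi v).map (sqDist b)) :=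
  Measure.isProbabilityMeasure_map (measurable_sqDist b).aemeasurable

lemma map_sqDist_le_of_lintegral {v : ι → ℝ≥0} {K : ℝ}
    (h : ∫⁻ t : ℝ, ENNReal.ofReal (∏ i, (1 + 4 * (v i : ℝ) ^ 2 * t ^ 2) ^ (-(1 / 4) : ℝ)) ≤
      ENNReal.ofReal K) (b : ι → ℝ) :
    (gaussianPi v).map (sqDist b) ≤ ENNReal.ofReal K • volume := by
  refine le_smul_volume_of_charFun (le_trans (lintegral_mono fun t ↦ ?_) h)
  rw [← ofReal_norm]
  exact ENNReal.ofReal_le_ofReal (norm_charFun_map_sqDist_le v b t)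

/-- The density of the squared norm if no variance dominates. -/
lemma map_sqDist_le_of_forall_le {v : ι → ℝ≥0} {L : ℝ} (hL : 0 < L)
    (h3 : ∀ i, 3 * (v i : ℝ) ^ 2 ≤ L) (hsum : 5 / 6 * L ≤ ∑ i, (v i : ℝ) ^ 2) (b : ι → ℝ) :
    (gaussianPi v).map (sqDist b) ≤
      ENNReal.ofReal ((∫ x : ℝ, (1 + x ^ 2) ^ (-(5 / 8) : ℝ)) * (√L)⁻¹) • volume := by
  refine map_sqDist_le_of_lintegral ?_ b
  have hc : 0 ≤ ∫ x : ℝ, (1 + x ^ 2) ^ (-(5 / 8) : ℝ) := integral_nonneg fun x ↦ by positivity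
  refine (lintegral_mono fun t ↦ ENNReal.ofReal_le_ofReal
    (prod_rpow_le hL (fun i _ ↦ h3 i) hsum t)).trans ?_
  rw [lintegral_ofReal_comp_mul_left (f := fun x ↦ (1 + x ^ 2) ^ (-(5 / 8) : ℝ))
    integrable_rpow_one_add_sq (fun x ↦ by positivity) (by positivity), ← div_eq_mul_inv]
  refine ENNReal.ofReal_le_ofReal ?_
  gcongr
  linarith

/-- The density of the squared norm if one variance dominates and no second one does. -/
lemma map_sqDist_le_of_forall_ne_le [DecidableEq ι] {v : ι → ℝ≥0} {k : ι} (hk : v k ≠ 0) {L : ℝ}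
    (hL : 0 < L) (h3 : ∀ i ≠ k, 3 * (v i : ℝ) ^ 2 ≤ L)
    (hsum : 5 / 6 * L ≤ ∑ i ∈ Finset.univ.erase k, (v i : ℝ) ^ 2) (b : ι → ℝ) :
    (gaussianPi v).map (sqDist b) ≤
      ENNReal.ofReal ((∫ x : ℝ, |x| ^ (-(1 / 2) : ℝ) * (1 + x ^ 2) ^ (-(5 / 8) : ℝ)) *
        (v k * √L) ^ (-(1 / 2) : ℝ)) • volume := by
  refine map_sqDist_le_of_lintegral ?_ b
  set c := ∫ x : ℝ, |x| ^ (-(1 / 2) : ℝ) * (1 + x ^ 2) ^ (-(5 / 8) : ℝ)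
  have hc : 0 ≤ c := integral_nonneg fun x ↦ by positivity
  have hk' : 0 < (v k : ℝ) := by positivity
  set α := √(4 * L / 3) with hα
  have hα0 : 0 < α := by positivity
  have hαL : √L ≤ α := Real.sqrt_le_sqrt (by linarith)
  -- The k-th factor is replaced by (2vₖ|t|)^(−1/2). At t = 0 this fails, as `0 ^ (-(1 / 2))`
  -- evaluates to 0.
  have hae : ∀ᵐ t : ℝ, t ≠ 0 := by simp [ae_iff]
  calc ∫⁻ t : ℝ, ENNReal.ofReal (∏ i, (1 + 4 * (v i : ℝ) ^ 2 * t ^ 2) ^ (-(1 / 4) : ℝ))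
    _ ≤ ∫⁻ t : ℝ, ENNReal.ofReal ((2 * v k / α) ^ (-(1 / 2) : ℝ)) *
        ENNReal.ofReal (|α * t| ^ (-(1 / 2) : ℝ) * (1 + (α * t) ^ 2) ^ (-(5 / 8) : ℝ)) := by
      refine lintegral_mono_ae (hae.mono fun t ht ↦ ?_)
      rw [← ENNReal.ofReal_mul (by positivity), ← mul_assoc]
      refine ENNReal.ofReal_le_ofReal ?_
      rw [← Finset.mul_prod_erase _ _ (Finset.mem_univ k)]
      refine mul_le_mul ?_ (prod_rpow_le hL (fun i hi ↦ h3 i (Finset.ne_of_mem_erase hi)) hsum t)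
        (Finset.prod_nonneg fun i _ ↦ by positivity) (by positivity)
      have ht' : 0 < |t| := abs_pos.2 ht
      rw [← Real.mul_rpow (by positivity) (by positivity), abs_mul, abs_of_pos hα0,
        show 2 * v k / α * (α * |t|) = 2 * v k * |t| by field_simp,
        show (-(1 / 2) : ℝ) = 2 * (-(1 / 4)) by norm_num, Real.rpow_mul (by positivity)]
      refine Real.rpow_le_rpow_of_nonpos (by positivity) ?_ (by norm_num)
      rw [Real.rpow_two, mul_pow, sq_abs]
      linarith
    _ = ENNReal.ofReal ((2 * v k / α) ^ (-(1 / 2) : ℝ)) * ENNReal.ofReal (c / α) := by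
      rw [lintegral_const_mul' _ _ ENNReal.ofReal_ne_top, lintegral_ofReal_comp_mul_left
        (f := fun x ↦ |x| ^ (-(1 / 2) : ℝ) * (1 + x ^ 2) ^ (-(5 / 8) : ℝ))
        integrable_abs_rpow_mul_rpow_one_add_sq (fun x ↦ by positivity) hα0]
    _ ≤ _ := by
      rw [← ENNReal.ofReal_mul (by positivity)]
      refine ENNReal.ofReal_le_ofReal ?_
      have e : (2 * v k / α) ^ (-(1 / 2) : ℝ) * (c / α) = c * (2 * v k * α) ^ (-(1 / 2) : ℝ) := by
        have : (α : ℝ)⁻¹ = (α ^ 2) ^ (-(1 / 2) : ℝ) := by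
          rw [← Real.rpow_natCast, ← Real.rpow_mul hα0.le, ← Real.rpow_neg_one]
          norm_num
        rw [div_eq_mul_inv c, this, mul_left_comm, ← Real.mul_rpow (by positivity) (by positivity)]
        congr 2
        field_simp
      rw [e]
      gcongr ?_ * ?_
      refine Real.rpow_le_rpow_of_nonpos (by positivity) ?_ (by norm_num)
      nlinarith [mul_le_mul_of_nonneg_left hαL hk'.le, mul_pos hk' hα0]

/-! ### The squared norm of a planar Gaussian vector -/

lemma volume_sq_add_sq_mem_Ioc_le (b c p q : ℝ) :
    volume {z : ℝ × ℝ | (z.1 - b) ^ 2 + (z.2 - c) ^ 2 ∈ Set.Ioc p q} ≤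
      ENNReal.ofReal (Real.pi * (q - p)) := by
  rcases lt_or_ge q p with hpq | hpq
  · simp [Set.Ioc_eq_empty hpq.not_gt]
  rcases lt_or_ge q 0 with hq | hq
  · rw [show {z : ℝ × ℝ | (z.1 - b) ^ 2 + (z.2 - c) ^ 2 ∈ Set.Ioc p q} = ∅ from
      Set.eq_empty_of_forall_notMem fun z hz ↦ by
        have : (z.1 - b) ^ 2 + (z.2 - c) ^ 2 ≤ q := hz.2
        nlinarith [sq_nonneg (z.1 - b), sq_nonneg (z.2 - c)]]
    simp
  have hm : MeasurableSet {z : ℝ × ℝ | (z.1 - b) ^ 2 + (z.2 - c) ^ 2 ∈ Set.Ioc p q} :=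
    measurableSet_Ioc.preimage (f := fun z : ℝ × ℝ ↦ (z.1 - b) ^ 2 + (z.2 - c) ^ 2) (by fun_prop)
  rw [← Complex.volume_preserving_equiv_real_prod.measure_preimage hm.nullMeasurableSet]
  have hnorm (z : ℂ) : ‖z - ⟨b, c⟩‖ ^ 2 = (z.re - b) ^ 2 + (z.im - c) ^ 2 := by
    rw [Complex.sq_norm, Complex.normSq_apply]
    simp only [Complex.sub_re, Complex.sub_im]
    ring
  have hsub : Complex.measurableEquivRealProd ⁻¹'
      {z : ℝ × ℝ | (z.1 - b) ^ 2 + (z.2 - c) ^ 2 ∈ Set.Ioc p q} ⊆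
      Metric.closedBall ⟨b, c⟩ (√q) \ Metric.ball ⟨b, c⟩ (√p) := by
    intro z hz
    have hz' : (z.re - b) ^ 2 + (z.im - c) ^ 2 ∈ Set.Ioc p q := hz
    rw [← hnorm] at hz'
    refine ⟨?_, ?_⟩
    · rw [mem_closedBall_iff_norm]
      exact Real.le_sqrt_of_sq_le hz'.2
    · rw [mem_ball_iff_norm, not_lt]
      exact Real.sqrt_le_iff.2 ⟨norm_nonneg _, hz'.1.le⟩
  refine (measure_mono hsub).trans ?_
  rw [measure_sdiff (Metric.ball_subset_closedBall.trans
    (Metric.closedBall_subset_closedBall (Real.sqrt_le_sqrt hpq)))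
    measurableSet_ball.nullMeasurableSet (by simp [Complex.volume_ball, ENNReal.mul_eq_top]),
    Complex.volume_closedBall, Complex.volume_ball, ← ENNReal.ofReal_pow (Real.sqrt_nonneg _),
    ← ENNReal.ofReal_pow (Real.sqrt_nonneg _), Real.sq_sqrt hq]
  have hpi : (NNReal.pi : ℝ≥0∞) = ENNReal.ofReal Real.pi := by
    rw [← NNReal.coe_real_pi, ENNReal.ofReal_coe_nnreal]
  rw [hpi, ← ENNReal.ofReal_mul hq, ← ENNReal.ofReal_mul (by positivity),
    ← ENNReal.ofReal_sub _ (by positivity)]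
  refine ENNReal.ofReal_le_ofReal ?_
  -- For negative p the inner disc is empty, since `√p = 0`.
  have : p ≤ √p ^ 2 := by
    rcases le_or_gt 0 p with h | h
    · rw [Real.sq_sqrt h]
    · exact h.le.trans (sq_nonneg _)
  nlinarith [Real.pi_pos]

/-- The maximum 1/(2π√(vw)) of the planar density times the annulus area π(q − p). The Fourier bound
is unavailable here: two factors of order |t|^(−1/2) are not integrable at infinity. -/
lemma map_sq_add_sq_le {v w : ℝ≥0} (hv : v ≠ 0) (hw : w ≠ 0) (b c : ℝ) :
    ((gaussianReal 0 v).prod (gaussianReal 0 w)).map (fun z ↦ (z.1 - b) ^ 2 + (z.2 - c) ^ 2) ≤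
      ENNReal.ofReal ((v * w : ℝ) ^ (-(1 / 2) : ℝ)) • volume := by
  refine le_smul_volume_of_Ioc fun p q hpq ↦ ?_
  rw [Measure.map_apply (by fun_prop) measurableSet_Ioc]
  refine (Measure.prod_mono (gaussianReal_le_smul_volume hv) (gaussianReal_le_smul_volume hw)
    _).trans ?_
  have hv' : (0 : ℝ) < v := by positivity
  have hw' : (0 : ℝ) < w := by positivity
  rw [Measure.prod_smul_left, Measure.prod_smul_right, Measure.smul_apply, Measure.smul_apply,
    smul_eq_mul, smul_eq_mul, ← Measure.volume_eq_prod]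
  refine (mul_le_mul_right (mul_le_mul_right (volume_sq_add_sq_mem_Ioc_le b c p q) _) _).trans ?_
  change _ ≤ ENNReal.ofReal _ * _
  rw [← ENNReal.ofReal_mul (by positivity), ← ENNReal.ofReal_mul (by positivity),
    ← ENNReal.ofReal_mul (by positivity)]
  refine ENNReal.ofReal_le_ofReal ?_
  have e : (√(2 * Real.pi * v))⁻¹ * (√(2 * Real.pi * w))⁻¹ =
      (2 * Real.pi)⁻¹ * (v * w : ℝ) ^ (-(1 / 2) : ℝ) := by
    rw [← mul_inv, ← Real.sqrt_mul (by positivity),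
      show 2 * Real.pi * v * (2 * Real.pi * w) = (2 * Real.pi) ^ 2 * (v * w) by ring,
      Real.sqrt_mul (by positivity), Real.sqrt_sq (by positivity), mul_inv,
      Real.sqrt_eq_rpow, ← Real.rpow_neg (by positivity)]
  rw [← mul_assoc, e, show (2 * Real.pi)⁻¹ * (v * w : ℝ) ^ (-(1 / 2) : ℝ) * (Real.pi * (q - p)) =
    (v * w : ℝ) ^ (-(1 / 2) : ℝ) * (q - p) / 2 by field_simp]
  have : 0 ≤ (v * w : ℝ) ^ (-(1 / 2) : ℝ) * (q - p) :=
    mul_nonneg (by positivity) (sub_nonneg.2 hpq)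
  linarith

/-- Conditionally on the first summand, the sum is a translate of τ, and Lebesgue measure is
translation invariant. -/
lemma map_add_prod_le_smul_volume {ρ τ : Measure ℝ} [IsProbabilityMeasure ρ] [SFinite τ]
    {M : ℝ≥0∞} (hτ : τ ≤ M • volume) :
    (ρ.prod τ).map (fun p ↦ p.1 + p.2) ≤ M • volume := by
  refine Measure.le_iff.2 fun s hs ↦ ?_
  have hm : Measurable fun p : ℝ × ℝ ↦ p.1 + p.2 := by fun_prop
  rw [Measure.map_apply hm hs, Measure.prod_apply (hs.preimage hm)]
  refine (lintegral_mono fun r ↦ (hτ _)).trans ?_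
  have (r : ℝ) : volume (Prod.mk r ⁻¹' ((fun p : ℝ × ℝ ↦ p.1 + p.2) ⁻¹' s)) = volume s := by
    rw [← measure_preimage_add volume r s]; rfl
  simp [this]

/-- The density of the squared norm if there are two large variances. -/
lemma map_sqDist_le_of_ne {v : ι → ℝ≥0} {j k : ι} (hjk : j ≠ k) (hj : v j ≠ 0) (hk : v k ≠ 0)
    (b : ι → ℝ) :
    (gaussianPi v).map (sqDist b) ≤
      ENNReal.ofReal ((v j * v k : ℝ) ^ (-(1 / 2) : ℝ)) • volume := by
  classical
  have hind : iIndepFun (fun i (x : ι → ℝ) ↦ x i) (gaussianPi v) :=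
    iIndepFun_pi (X := fun _ z ↦ z) fun i ↦ aemeasurable_id
  have hT : Disjoint ({j, k} : Finset ι)ᶜ {j, k} := disjoint_compl_left
  let R : (ι → ℝ) → ℝ := fun x ↦ ∑ i ∈ ({j, k} : Finset ι)ᶜ, (x i - b i) ^ 2
  let W : (ι → ℝ) → ℝ := fun x ↦ (x j - b j) ^ 2 + (x k - b k) ^ 2
  have hR : Measurable R := by fun_prop
  have hW : Measurable W := by fun_prop
  have h1 : IndepFun R W (gaussianPi v) := by
    convert (hind.indepFun_finset _ _ hT (fun i ↦ measurable_pi_apply i)).comp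
      (φ := fun y : (({j, k} : Finset ι)ᶜ : Finset ι) → ℝ ↦ ∑ i, (y i - b i) ^ 2)
      (ψ := fun y : ({j, k} : Finset ι) → ℝ ↦
        (y ⟨j, by simp⟩ - b j) ^ 2 + (y ⟨k, by simp⟩ - b k) ^ 2)
      (by fun_prop) (by fun_prop) using 1
    · ext x
      exact (Finset.sum_coe_sort _ (fun i ↦ (x i - b i) ^ 2)).symm
    · rfl
  have hp := (indepFun_iff_map_prod_eq_prod_map_map (measurable_pi_apply j).aemeasurable
    (measurable_pi_apply k).aemeasurable).1 (hind.indepFun hjk)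
  have he (i : ι) : (gaussianPi v).map (fun x ↦ x i) = gaussianReal 0 (v i) :=
    (measurePreserving_eval (fun i ↦ gaussianReal 0 (v i)) i).map_eq
  rw [he, he] at hp
  have h2 := map_sq_add_sq_le hj hk (b j) (b k)
  rw [← hp, Measure.map_map (by fun_prop) (by fun_prop)] at h2
  have h3 := (indepFun_iff_map_prod_eq_prod_map_map hR.aemeasurable hW.aemeasurable).1 h1
  have hprob : IsProbabilityMeasure ((gaussianPi v).map R) :=
    Measure.isProbabilityMeasure_map hR.aemeasurable
  refine le_trans (le_of_eq ?_) (map_add_prod_le_smul_volume (ρ := (gaussianPi v).map R)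
    (τ := (gaussianPi v).map W) h2)
  rw [← h3, Measure.map_map (by fun_prop) (hR.prodMk hW)]
  congr 1
  ext x
  simp only [sqDist, Function.comp_apply, R, W]
  rw [← Finset.sum_pair hjk (f := fun i ↦ (x i - b i) ^ 2), Finset.sum_compl_add_sum]

end GaussianComparison

namespace GaussianComparison

/-! ### Sorting a family of reals in non-increasing order -/

/-- The `n`-th largest positive value of the family `c`, and `0` if there is none. -/
def sorted {ι : Type*} (c : ι → ℝ) (n : ℕ) : ℝ :=
  sSup {t : ℝ | 0 < t ∧ n + 1 ≤ {i | t ≤ c i}.ncard}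

section Sorted

variable {ι : Type*} {c : ι → ℝ}

lemma sorted_nonneg (c : ι → ℝ) (n : ℕ) : 0 ≤ sorted c n :=
  Real.sSup_nonneg fun _ ht ↦ ht.1.le

/-- The bound `B` is essential: `sSup` of an unbounded set is 0, which would break monotonicity. -/
lemma sorted_antitone {B : ℝ} (hB : ∀ i, c i ≤ B) : Antitone (sorted c) := by
  intro m n hmn
  rcases Set.eq_empty_or_nonempty {t : ℝ | 0 < t ∧ n + 1 ≤ {i | t ≤ c i}.ncard} with h | h
  · rw [sorted, h, Real.sSup_empty]
    exact sorted_nonneg c m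
  · refine csSup_le_csSup ⟨B, fun t ht ↦ ?_⟩ h fun t ht ↦ ⟨ht.1, by have := ht.2; omega⟩
    obtain ⟨i, hi⟩ : {i | t ≤ c i}.Nonempty :=
      Set.nonempty_of_ncard_ne_zero (by have := ht.2; omega)
    exact le_trans hi (hB i)

/-- The rank of a positive entry is the number of entries preceding it in decreasing order, ties
being broken by an auxiliary linear order on the index type. Equal values thus receive distinct
ranks, and the unused ranks carry the value 0. -/
lemma exists_injective_sorted (hfin : ∀ t > 0, {i | t ≤ c i}.Finite) :
    ∃ r : {i // 0 < c i} → ℕ, Function.Injective r ∧ (∀ i, sorted c (r i) = c i) ∧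
      ∀ n, n ∉ Set.range r → sorted c n = 0 := by
  obtain ⟨_, _⟩ := exists_wellFoundedLT ι
  let pred : ι → Set ι := fun i ↦ {j | c i < c j ∨ c j = c i ∧ j < i}
  have hself (i : ι) : i ∉ pred i := by simp [pred]
  have hsub (i : ι) (t : ℝ) (ht : t ≤ c i) : insert i (pred i) ⊆ {j | t ≤ c j} := by
    rintro j (rfl | hj | ⟨hj, -⟩)
    exacts [ht, ht.trans hj.le, ht.trans hj.ge]
  have hpfin (i : ι) (hi : 0 < c i) : (pred i).Finite :=
    (hfin _ hi).subset ((Set.subset_insert _ _).trans (hsub i _ le_rfl))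
  have hcard (i : ι) (hi : 0 < c i) : (insert i (pred i)).ncard = (pred i).ncard + 1 :=
    Set.ncard_insert_of_notMem (hself i) (hpfin i hi)
  have hlt (i j : ι) (hj : 0 < c j) (hij : i ∈ pred j) :
      (pred i).ncard < (pred j).ncard := by
    refine Set.ncard_lt_ncard (Set.ssubset_iff_of_subset ?_ |>.2 ⟨i, hij, hself i⟩) (hpfin j hj)
    rintro k (hk | ⟨hk, hk'⟩) <;> rcases hij with h | ⟨h, h'⟩
    · exact Or.inl (h.trans hk)
    · exact Or.inl (h ▸ hk)
    · exact Or.inl (hk ▸ h)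
    · exact Or.inr ⟨hk.trans h, hk'.trans h'⟩
  let r : {i // 0 < c i} → ℕ := fun i ↦ (pred i).ncard
  have hr : Function.Injective r := by
    intro i j hij
    by_contra hne
    have hne' : (i : ι) ≠ j := fun h ↦ hne (Subtype.ext h)
    rcases lt_trichotomy (c i) (c j) with h | h | h
    · exact (hlt j i i.2 (Or.inl h)).ne' hij
    · rcases lt_or_gt_of_ne hne' with h' | h'
      · exact (hlt i j j.2 (Or.inr ⟨h, h'⟩)).ne hij
      · exact (hlt j i i.2 (Or.inr ⟨h.symm, h'⟩)).ne' hij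
    · exact (hlt i j j.2 (Or.inl h)).ne hij
  refine ⟨r, hr, fun i ↦ ?_, fun n hn ↦ ?_⟩
  · refine IsGreatest.csSup_eq ⟨⟨i.2, ?_⟩, fun t ht ↦ ?_⟩
    · rw [← hcard i i.2]
      exact Set.ncard_le_ncard (hsub i _ le_rfl) (hfin _ i.2)
    · by_contra! h
      have := Set.ncard_le_ncard (s := {j | t ≤ c j}) (t := pred i)
        (fun j hj ↦ Or.inl (h.trans_le hj)) (hpfin i i.2)
      exact absurd (ht.2.trans this) (by simp [r])
  · rw [sorted]
    convert Real.sSup_empty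
    refine Set.eq_empty_of_forall_notMem fun t ht ↦ hn ?_
    have hf := hfin t ht.1
    let S : Finset {i // 0 < c i} := hf.toFinset.subtype _
    have hScard : S.card = {i | t ≤ c i}.ncard := by
      rw [Finset.card_subtype, Finset.filter_true_of_mem, Set.ncard_eq_toFinset_card _ hf]
      intro i hi
      exact ht.1.trans_le (by simpa using hi)
    -- The ranks of the entries ≥ t lie in an initial segment of the same cardinality, so they fill
    -- it without gaps.
    have himg : S.image r = Finset.range S.card := by
      refine Finset.eq_of_subset_of_card_le (fun m hm ↦ ?_) ?_
      · obtain ⟨i, hi, rfl⟩ := Finset.mem_image.1 hm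
        have hi' : t ≤ c i := by simpa [S] using hi
        rw [Finset.mem_range, hScard]
        refine Nat.lt_of_succ_le ?_
        rw [Nat.succ_eq_add_one, ← hcard i i.2]
        exact Set.ncard_le_ncard (hsub i t hi') hf
      · rw [Finset.card_range, Finset.card_image_of_injective _ hr]
    have : n ∈ S.image r := by
      rw [himg, Finset.mem_range, hScard]
      exact ht.2
    obtain ⟨i, -, hi⟩ := Finset.mem_image.1 this
    exact ⟨i, hi⟩

end Sorted

/-! ### Eigenbases of compact positive operators -/

variable {H : Type u} [NormedAddCommGroup H] [InnerProductSpace ℝ H]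

/-- Orthonormal bases of all eigenspaces, kernel included, are put together; they are complete by
the spectral theorem for compact self-adjoint operators. -/
lemma exists_eigenbasis [CompleteSpace H] {T : H →L[ℝ] H} (hT : IsCompactOperator T)
    (hp : (T : H →ₗ[ℝ] H).IsPositive) :
    ∃ (ι : Type u) (b : HilbertBasis ι ℝ H) (c : ι → ℝ),
      (∀ i, 0 ≤ c i) ∧ ∀ i, T (b i) = c i • b i := by
  have hsymm := hp.1
  choose w e he using fun s : ℝ ↦ exists_hilbertBasis ℝ (Module.End.eigenspace (T : H →ₗ[ℝ] H) s)
  have hon := hsymm.orthogonalFamily_eigenspaces.orthonormal_sigma_orthonormal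
    (v_family := fun s ↦ e s) (fun s ↦ (e s).orthonormal)
  have hbot : (Submodule.span ℝ (Set.range fun a : Σ s, w s ↦
      (Module.End.eigenspace (T : H →ₗ[ℝ] H) a.1).subtypeₗᵢ (e a.1 a.2)))ᗮ = ⊥ := by
    rw [eq_bot_iff, ← ContinuousLinearMap.orthogonalComplement_iSup_eigenspaces_eq_bot hT hsymm]
    intro x hx
    rw [← Submodule.iInf_orthogonal, Submodule.mem_iInf]
    intro s
    have hx' (i : w s) : inner ℝ ((e s i : Module.End.eigenspace (T : H →ₗ[ℝ] H) s) : H) x = 0 :=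
      (Submodule.mem_orthogonal _ _).1 hx _ (Submodule.subset_span ⟨⟨s, i⟩, rfl⟩)
    rw [Submodule.mem_orthogonal]
    intro u hu
    have h := ((e s).hasSum_repr ⟨u, hu⟩).mapL
      ((innerSL ℝ x).comp (Module.End.eigenspace (T : H →ₗ[ℝ] H) s).subtypeL)
    have h0 : ∀ i, ((innerSL ℝ x).comp (Module.End.eigenspace (T : H →ₗ[ℝ] H) s).subtypeL)
        ((e s).repr ⟨u, hu⟩ i • e s i) = 0 := by
      intro i
      have : inner ℝ x (e s i : H) = 0 := by rw [real_inner_comm, hx' i]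
      simp [this]
    simp only [h0] at h
    have := h.unique hasSum_zero
    rw [real_inner_comm]
    simpa using this
  refine ⟨Σ s, w s, HilbertBasis.mkOfOrthogonalEqBot hon hbot, fun a ↦ a.1, ?_, ?_⟩
  · rintro ⟨s, i⟩
    have hmem := (e s i).2
    rw [Module.End.mem_eigenspace_iff] at hmem
    have h1 := hp.2 (e s i : H)
    have h2 : ‖(e s i : H)‖ = 1 := (e s).orthonormal.1 i
    rw [hmem] at h1
    simpa [real_inner_smul_left, h2] using h1
  · rintro ⟨s, i⟩
    rw [HilbertBasis.coe_mkOfOrthogonalEqBot]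
    exact Module.End.mem_eigenspace_iff.1 (e s i).2

section Eigenbasis

variable {ι : Type*} {T : H →L[ℝ] H} {b : HilbertBasis ι ℝ H} {c : ι → ℝ}

lemma HilbertBasis.eq_zero_of_inner (b : HilbertBasis ι ℝ H) {x : H} (h : ∀ i, inner ℝ x (b i) = 0) :
    x = 0 := by
  have := b.hasSum_inner_mul_inner x x
  simp only [h, zero_mul] at this
  exact inner_self_eq_zero.1 (this.unique hasSum_zero)

/-- By symmetry an eigenvector for s is orthogonal to every basis vector with c i ≠ s, so its
expansion only involves the finitely many i with t ≤ c i. -/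
lemma upperEigenspace_eq_span (hs : (T : H →ₗ[ℝ] H).IsSymmetric) (hb : ∀ i, T (b i) = c i • b i)
    {t : ℝ} (hfin : {i | t ≤ c i}.Finite) :
    upperEigenspace T t = Submodule.span ℝ (b '' {i | t ≤ c i}) := by
  refine le_antisymm (iSup₂_le fun s hst x hx ↦ ?_) (Submodule.span_le.2 ?_)
  · have hTx : T x = s • x := Module.End.mem_eigenspace_iff.1 hx
    have hx0 (i : ι) (hi : c i ≠ s) : inner ℝ x (b i) = 0 := by
      have h := hs x (b i)
      rw [ContinuousLinearMap.coe_coe, hTx, hb, real_inner_smul_left, real_inner_smul_right] at h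
      have : (c i - s) * inner ℝ x (b i) = 0 := by linarith
      exact (mul_eq_zero.1 this).resolve_left (sub_ne_zero.2 hi)
    have hsum : x = ∑ i ∈ hfin.toFinset, inner ℝ x (b i) • b i := by
      classical
      rw [← sub_eq_zero]
      refine HilbertBasis.eq_zero_of_inner b fun j ↦ ?_
      rw [inner_sub_left, sum_inner]
      simp only [real_inner_smul_left, orthonormal_iff_ite.1 b.orthonormal, mul_ite, mul_one,
        mul_zero, Finset.sum_ite_eq']
      split_ifs with hj
      · ring
      · rw [sub_zero]
        refine hx0 j fun h ↦ hj ?_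
        simpa [h] using hst
    rw [hsum]
    refine Submodule.sum_mem _ fun i hi ↦ Submodule.smul_mem _ _ (Submodule.subset_span ?_)
    exact ⟨i, by simpa using hi, rfl⟩
  · rintro _ ⟨i, hi, rfl⟩
    exact Submodule.mem_iSup_of_mem (c i) (Submodule.mem_iSup_of_mem hi
      (Module.End.mem_eigenspace_iff.2 (hb i)))

lemma orderedEigenvalue_eq_sorted (hs : (T : H →ₗ[ℝ] H).IsSymmetric)
    (hb : ∀ i, T (b i) = c i • b i) (hfin : ∀ t > 0, {i | t ≤ c i}.Finite) :
    orderedEigenvalue T = sorted c := by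
  ext n
  rw [orderedEigenvalue, sorted]
  congr 1
  ext t
  refine and_congr_right fun ht ↦ ?_
  have hli : LinearIndepOn ℝ id (b '' {i | t ≤ c i}) :=
    (b.orthonormal.linearIndependent.comp (fun i : {i | t ≤ c i} ↦ (i : ι))
      Subtype.val_injective).linearIndepOn_id' (by ext; simp)
  rw [upperEigenspace_eq_span hs hb (hfin t ht), rank_span_set hli,
    ← Set.cast_ncard ((hfin t ht).image b), Nat.cast_le,
    Set.ncard_image_of_injective _ b.orthonormal.linearIndependent.injective]

end Eigenbasis

/-! ### Countability of orthonormal families and compactness of the covariance operator -/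

lemma countable_of_orthonormal [TopologicalSpace.SeparableSpace H] {ι : Type*} {e : ι → H}
    (he : Orthonormal ℝ e) : Countable ι := by
  refine Pairwise.countable_of_isOpen_disjoint (s := fun i ↦ Metric.ball (e i) (1 / 2)) ?_
    (fun i ↦ Metric.isOpen_ball) (fun i ↦ ⟨e i, Metric.mem_ball_self (by norm_num)⟩)
  intro i j hij
  refine Metric.ball_disjoint_ball ?_
  rw [dist_eq_norm]
  have h : ‖e i - e j‖ ^ 2 = 2 := by
    rw [norm_sub_sq_real, he.1, he.1, he.2 hij]
    norm_num
  nlinarith [norm_nonneg (e i - e j)]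

variable [CompleteSpace H] [SecondCountableTopology H] [MeasurableSpace H] [BorelSpace H]

/-- The covariance is a Bochner integral of the rank-one operators y ⊗ y, and the compact operators
form a closed subspace. -/
lemma isCompactOperator_covarianceOperator {μ : Measure H} [IsProbabilityMeasure μ]
    (hμ : MemLp id 2 μ) : IsCompactOperator (covarianceOperator μ) := by
  have hcont : Continuous fun y : H ↦ InnerProductSpace.rankOne ℝ y y :=
    (InnerProductSpace.rankOne ℝ (E := H) (F := H)).continuous.clm_apply continuous_id
  have h_int : Integrable (fun y : H ↦ InnerProductSpace.rankOne ℝ y y) μ := by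
    refine Integrable.mono' (g := fun y ↦ ‖y‖ ^ 2) hμ.integrable_norm_pow'
      hcont.aestronglyMeasurable (Filter.Eventually.of_forall fun y ↦ ?_)
    rw [InnerProductSpace.norm_rankOne, sq]
  have heq : covarianceOperator μ = ∫ y, InnerProductSpace.rankOne ℝ y y ∂μ := by
    ext x
    rw [covarianceOperator_apply hμ, ContinuousLinearMap.integral_apply h_int]
    simp [real_inner_comm]
  have := Convex.integral_mem (s := (compactOperator (RingHom.id ℝ) H H : Set (H →L[ℝ] H)))
    (Submodule.convex _) isClosed_setOfPred_isCompactOperator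
    (Filter.Eventually.of_forall fun y ↦ ?_) h_int
  · rw [heq]; exact this
  · have h1 : IsCompactOperator ((ContinuousLinearMap.id ℝ ℝ).smulRight y) :=
      isCompactOperator_of_locallyCompactSpace_rng ((ContinuousLinearMap.id ℝ ℝ).smulRight y)
    have h2 := h1.comp_clm (innerSL ℝ y)
    exact h2

end GaussianComparison

namespace GaussianComparison

/-! ### Gaussian coordinates -/

variable {H : Type u} [NormedAddCommGroup H] [InnerProductSpace ℝ H]

lemma orderedEigenvalue_nonneg (T : H →L[ℝ] H) (n : ℕ) : 0 ≤ orderedEigenvalue T n :=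
  Real.sSup_nonneg fun _ ht ↦ ht.1.le

variable [CompleteSpace H] [SecondCountableTopology H] [MeasurableSpace H] [BorelSpace H]
  {Ω : Type v} [MeasurableSpace Ω] {P : Measure Ω} {ξ : Ω → H}

lemma integral_inner_mul_inner (hξ : HasGaussianLaw ξ P) (x y : H) :
    ∫ ω, inner ℝ x (ξ ω) * inner ℝ y (ξ ω) ∂P =
      inner ℝ (covarianceOperator (P.map ξ) x) y := by
  have hm : MemLp id 2 (P.map ξ) :=
    (memLp_map_measure_iff aestronglyMeasurable_id hξ.aemeasurable).2 hξ.memLp_two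
  rw [covarianceOperator_inner hm, integral_map hξ.aemeasurable
    (Continuous.aestronglyMeasurable (by fun_prop))]

lemma integrable_inner_mul_inner (hξ : HasGaussianLaw ξ P) (x y : H) :
    Integrable (fun ω ↦ inner ℝ x (ξ ω) * inner ℝ y (ξ ω)) P :=
  (hξ.memLp_two.const_inner x).integrable_mul (hξ.memLp_two.const_inner y)

/-- Coordinates along finitely many vectors that are orthogonal with respect to the covariance
operator are independent Gaussian variables. -/
lemma map_inner_eq_gaussianPi [IsProbabilityMeasure P] (hξ : HasGaussianLaw ξ P) (h0 : ∫ ω, ξ ω ∂P = 0) {n : ℕ}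
    {f : Fin n → H} {v : Fin n → ℝ≥0}
    (hne : ∀ i j, i ≠ j → inner ℝ (covarianceOperator (P.map ξ) (f i)) (f j) = 0)
    (heq : ∀ i, inner ℝ (covarianceOperator (P.map ξ) (f i)) (f i) = v i) :
    P.map (fun ω i ↦ inner ℝ (f i) (ξ ω)) = gaussianPi v := by
  have hG : HasGaussianLaw (fun ω i ↦ inner ℝ (f i) (ξ ω)) P :=
    hξ.map_fun (ContinuousLinearMap.pi fun i ↦ innerSL ℝ (f i))
  have hmean (i : Fin n) : ∫ ω, inner ℝ (f i) (ξ ω) ∂P = 0 := by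
    rw [integral_inner hξ.integrable, h0, inner_zero_right]
  have hcov (i j : Fin n) : cov[fun ω ↦ inner ℝ (f i) (ξ ω), fun ω ↦ inner ℝ (f j) (ξ ω); P] =
      inner ℝ (covarianceOperator (P.map ξ) (f i)) (f j) := by
    rw [covariance, ← integral_inner_mul_inner hξ]
    simp only [hmean, sub_zero]
  have hmeas (i : Fin n) : AEMeasurable (fun ω ↦ inner ℝ (f i) (ξ ω)) P :=
    (hξ.memLp_two.const_inner (f i)).aemeasurable
  have hind : iIndepFun (fun i ω ↦ inner ℝ (f i) (ξ ω)) P :=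
    hG.iIndepFun_of_covariance_eq_zero fun i j hij ↦ by rw [hcov, hne i j hij]
  rw [(iIndepFun_iff_map_fun_eq_pi_map hmeas).1 hind, gaussianPi]
  congr 1
  ext1 i
  have hGi : HasGaussianLaw (fun ω ↦ inner ℝ (f i) (ξ ω)) P := hξ.map_fun (innerSL ℝ (f i))
  rw [hGi.map_eq_gaussianReal, hmean, ← covariance_self (hmeas i), hcov, heq, Real.toNNReal_coe]

/-- Diagonalization of a centred Gaussian element of a Hilbert space: along suitable vectors `f n`
its coordinates are independent with the ordered eigenvalues as variances, and together they
determine the distance to every point. -/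
lemma exists_gaussian_coordinates [IsProbabilityMeasure P] (hξ : HasGaussianLaw ξ P)
    (h0 : ∫ ω, ξ ω ∂P = 0) :
    Antitone (orderedEigenvalue (covarianceOperator (P.map ξ))) ∧
    Summable (orderedEigenvalue (covarianceOperator (P.map ξ))) ∧
    ∃ f : ℕ → H,
      (∀ n : ℕ, P.map (fun ω (i : Fin n) ↦ inner ℝ (f i) (ξ ω)) = gaussianPi fun i : Fin n ↦
        (orderedEigenvalue (covarianceOperator (P.map ξ)) i).toNNReal) ∧
      ∀ a : H, ∃ d : ℝ, 0 ≤ d ∧ HasSum (fun n ↦ inner ℝ (f n) a ^ 2) (‖a‖ ^ 2 - d) ∧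
        ∀ᵐ ω ∂P, HasSum (fun n ↦ (inner ℝ (f n) (ξ ω) - inner ℝ (f n) a) ^ 2)
          (‖ξ ω - a‖ ^ 2 - d) := by
  have hm : MemLp id 2 (P.map ξ) :=
    (memLp_map_measure_iff aestronglyMeasurable_id hξ.aemeasurable).2 hξ.memLp_two
  have : IsProbabilityMeasure (P.map ξ) := Measure.isProbabilityMeasure_map hξ.aemeasurable
  set T := covarianceOperator (P.map ξ) with hT
  have hpos : (T : H →ₗ[ℝ] H).IsPositive := isPositive_covarianceOperator
  obtain ⟨ι, b, c, hc0, hb⟩ := exists_eigenbasis (isCompactOperator_covarianceOperator hm) hpos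
  have hcount : Countable ι := countable_of_orthonormal b.orthonormal
  have hcint (i : ι) : ∫ ω, inner ℝ (b i) (ξ ω) ^ 2 ∂P = c i := by
    simp_rw [sq]
    rw [integral_inner_mul_inner hξ, ← hT, hb, real_inner_smul_left, real_inner_self_eq_norm_sq,
      b.orthonormal.1]
    norm_num
  have hsqint (i : ι) : Integrable (fun ω ↦ inner ℝ (b i) (ξ ω) ^ 2) P := by
    simpa only [sq] using integrable_inner_mul_inner hξ (b i) (b i)
  have hcsum : Summable c := by
    refine summable_of_sum_le hc0 (c := ∫ ω, ‖ξ ω‖ ^ 2 ∂P) fun s ↦ ?_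
    simp_rw [← hcint]
    rw [← integral_finsetSum _ fun i _ ↦ hsqint i]
    refine integral_mono (integrable_finsetSum _ fun i _ ↦ hsqint i)
      hξ.memLp_two.integrable_norm_pow' fun ω ↦ ?_
    simpa only [Real.norm_eq_abs, sq_abs] using b.orthonormal.sum_inner_products_le (s := s) (ξ ω)
  have hfin : ∀ t > 0, {i | t ≤ c i}.Finite := by
    intro t ht
    have := hcsum.tendsto_cofinite_zero.eventually (gt_mem_nhds ht)
    rw [Filter.eventually_cofinite] at this
    simpa only [not_lt] using this
  have hsort : orderedEigenvalue T = sorted c := orderedEigenvalue_eq_sorted hpos.1 hb hfin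
  obtain ⟨r, hr, hrc, hr0⟩ := exists_injective_sorted hfin
  have hcomp : sorted c ∘ r = fun i : {i // 0 < c i} ↦ c i := funext hrc
  -- Eigenvectors are listed by rank; unused indices get the zero vector, matching the eigenvalue 0
  -- and a degenerate coordinate.
  set f : ℕ → H := Function.extend r (fun i ↦ b i) 0 with hf
  have hfr (i : {i // 0 < c i}) : f (r i) = b i := hr.extend_apply _ _ _
  have hf0 (n : ℕ) (hn : n ∉ Set.range r) : f n = 0 := by
    rw [hf, Function.extend_apply' _ _ _ hn]; rfl
  have hTf (n : ℕ) : T (f n) = sorted c n • f n := by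
    by_cases hn : n ∈ Set.range r
    · obtain ⟨i, rfl⟩ := hn
      rw [hfr, hb, hrc]
    · rw [hf0 n hn, map_zero, smul_zero]
  have horth (m n : ℕ) (hmn : m ≠ n) : inner ℝ (f m) (f n) = 0 := by
    by_cases hm : m ∈ Set.range r
    · by_cases hn : n ∈ Set.range r
      · obtain ⟨i, rfl⟩ := hm
        obtain ⟨j, rfl⟩ := hn
        rw [hfr, hfr]
        refine b.orthonormal.2 fun h ↦ hmn ?_
        rw [Subtype.ext h]
      · rw [hf0 n hn, inner_zero_right]
    · rw [hf0 m hm, inner_zero_left]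
  have hnorm (n : ℕ) : sorted c n * inner ℝ (f n) (f n) = sorted c n := by
    by_cases hn : n ∈ Set.range r
    · obtain ⟨i, rfl⟩ := hn
      rw [hfr, real_inner_self_eq_norm_sq, b.orthonormal.1]
      norm_num
    · rw [hr0 n hn, zero_mul]
  have hD (x : H) : HasSum (fun n ↦ inner ℝ (f n) x ^ 2)
      (‖x‖ ^ 2 - ∑' i : ({i | 0 < c i}ᶜ : Set ι), inner ℝ (b i) x ^ 2) := by
    have h1 : HasSum (fun i ↦ inner ℝ (b i) x ^ 2) (‖x‖ ^ 2) := by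
      have := b.hasSum_inner_mul_inner x x
      rw [real_inner_self_eq_norm_sq] at this
      have e : (fun i ↦ inner ℝ x (b i) * inner ℝ (b i) x) = fun i ↦ inner ℝ (b i) x ^ 2 :=
        funext fun i ↦ by rw [real_inner_comm, sq]
      rwa [e] at this
    have h2 := h1.summable.tsum_subtype_add_tsum_subtype_compl {i | 0 < c i}
    rw [h1.tsum_eq] at h2
    rw [← h2, add_sub_cancel_right]
    refine (hr.hasSum_iff ?_).1 ?_
    · intro n hn
      simp [hf0 n hn]
    · have := (h1.summable.subtype {i | 0 < c i}).hasSum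
      have e : (fun n ↦ inner ℝ (f n) x ^ 2) ∘ r = fun i : {i // 0 < c i} ↦ inner ℝ (b i) x ^ 2 :=
        funext fun i ↦ by rw [Function.comp_apply, hfr]
      rw [e]
      exact this
  rw [hsort]
  refine ⟨sorted_antitone (B := ∑' i, c i) fun i ↦ hcsum.le_tsum i fun j _ ↦ hc0 j, ?_, f, ?_, ?_⟩
  · refine (hr.summable_iff hr0).1 ?_
    rw [hcomp]
    exact hcsum.subtype {i | 0 < c i}
  · intro n
    refine map_inner_eq_gaussianPi hξ h0 (fun i j hij ↦ ?_) fun i ↦ ?_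
    · rw [← hT, hTf, real_inner_smul_left, horth _ _ (fun h ↦ hij (Fin.ext h)), mul_zero]
    · rw [← hT, hTf, real_inner_smul_left, hnorm, Real.coe_toNNReal _ (sorted_nonneg c i)]
  · intro a
    refine ⟨∑' i : ({i | 0 < c i}ᶜ : Set ι), inner ℝ (b i) a ^ 2, tsum_nonneg fun i ↦ sq_nonneg _,
      hD a, ?_⟩
    -- Coordinates of ξ along the kernel of the covariance have variance 0, so there ξ − a
    -- contributes the constant d, the squared norm of the kernel part of a.
    have hker : ∀ᵐ ω ∂P, ∀ i : ({i | 0 < c i}ᶜ : Set ι), inner ℝ (b i) (ξ ω) = 0 := by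
      rw [ae_all_iff]
      rintro ⟨i, hi⟩
      have hci : c i = 0 := le_antisymm (not_lt.1 hi) (hc0 i)
      have := (integral_eq_zero_iff_of_nonneg (fun ω ↦ sq_nonneg _) (hsqint i)).1
        ((hcint i).trans hci)
      filter_upwards [this] with ω hω
      exact pow_eq_zero_iff two_ne_zero |>.1 hω
    filter_upwards [hker] with ω hω
    have := hD (ξ ω - a)
    simp only [inner_sub_right, hω, zero_sub, neg_sq] at this
    exact this

end GaussianComparison

namespace GaussianComparison

variable {H : Type u} [NormedAddCommGroup H] [InnerProductSpace ℝ H]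

/-! ### Two-sided bounds for `kappa` -/

lemma tailNorm_sq (T : H →L[ℝ] H) (k : ℕ) :
    tailNorm T k ^ 2 = ∑' j : ℕ, ENNReal.ofReal (orderedEigenvalue T (k + j)) ^ 2 := by
  rw [tailNorm, ← ENNReal.rpow_natCast, ← ENNReal.rpow_mul]
  norm_num

lemma tailNorm_zero_sq (T : H →L[ℝ] H) :
    tailNorm T 0 ^ 2 = ENNReal.ofReal (orderedEigenvalue T 0) ^ 2 + tailNorm T 1 ^ 2 := by
  have h := tsum_eq_zero_add' (f := fun j ↦ ENNReal.ofReal (orderedEigenvalue T j) ^ 2)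
    ENNReal.summable
  simp only [tailNorm_sq, zero_add, add_comm 1, h]

lemma ofReal_orderedEigenvalue_le_tailNorm (T : H →L[ℝ] H) (k : ℕ) :
    ENNReal.ofReal (orderedEigenvalue T k) ≤ tailNorm T k := by
  rw [← ENNReal.pow_le_pow_left_iff two_ne_zero, tailNorm_sq]
  exact ENNReal.le_tsum (f := fun j ↦ ENNReal.ofReal (orderedEigenvalue T (k + j)) ^ 2) 0

lemma rpow_neg_half_le_mul {x y : ℝ≥0∞} {c : ℝ} (hc : 0 < c)
    (h : y ≤ ENNReal.ofReal c ^ 2 * x) :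
    x ^ (-(1 / 2) : ℝ) ≤ ENNReal.ofReal c * y ^ (-(1 / 2) : ℝ) := by
  have hc0 : ENNReal.ofReal c ≠ 0 := by simpa using hc
  have h1 : y ^ (1 / 2 : ℝ) ≤ ENNReal.ofReal c * x ^ (1 / 2 : ℝ) := by
    refine (ENNReal.rpow_le_rpow h (by norm_num)).trans_eq ?_
    rw [ENNReal.mul_rpow_of_nonneg _ _ (by norm_num), ← ENNReal.rpow_natCast, ← ENNReal.rpow_mul]
    norm_num
  rw [ENNReal.rpow_neg, ENNReal.rpow_neg]
  refine le_trans (le_of_eq ?_) (mul_le_mul_right (ENNReal.inv_le_inv.2 h1) _)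
  rw [ENNReal.mul_inv (Or.inl hc0) (Or.inl ENNReal.ofReal_ne_top), ← mul_assoc,
    ENNReal.mul_inv_cancel hc0 ENNReal.ofReal_ne_top, one_mul]

lemma le_ofReal_mul_of_sq_le {x y : ℝ≥0∞} {c : ℝ} (hc : 0 ≤ c) {q : ℝ} (hq : q ≤ c ^ 2)
    (h : x ^ 2 ≤ ENNReal.ofReal q * y ^ 2) : x ≤ ENNReal.ofReal c * y := by
  rw [← ENNReal.pow_le_pow_left_iff two_ne_zero, mul_pow, ← ENNReal.ofReal_pow hc]
  exact h.trans (mul_le_mul_left (ENNReal.ofReal_le_ofReal hq) _)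

lemma ofReal_mul_rpow_neg_half_le {x y : ℝ≥0∞} (h : x ≤ ENNReal.ofReal (1 / 0.9) ^ 2 * y) :
    ENNReal.ofReal 0.9 * y ^ (-(1 / 2) : ℝ) ≤ x ^ (-(1 / 2) : ℝ) := by
  refine (mul_le_mul_right (rpow_neg_half_le_mul (by norm_num) h) _).trans_eq ?_
  rw [← mul_assoc, ← ENNReal.ofReal_mul (by norm_num)]
  norm_num

/-- When λₖ dominates, Λₖ and λₖ agree up to √3 ≤ 1.8. When λ₁ does not, 2λ₁² ≤ Λ₂² gives Λ₁² ≤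
(3/2)Λ₂², and 3/2 ≤ 0.9⁻⁴ yields the lower bound. -/
theorem kappa_bounds (T : H →L[ℝ] H) :
    ENNReal.ofReal 0.9 * (tailNorm T 0 * tailNorm T 1) ^ (-(1 / 2) : ℝ) ≤ kappa T ∧
      kappa T ≤ ENNReal.ofReal 1.8 * (tailNorm T 0 * tailNorm T 1) ^ (-(1 / 2) : ℝ) := by
  set l₀ := ENNReal.ofReal (orderedEigenvalue T 0) with hl₀
  set l₁ := ENNReal.ofReal (orderedEigenvalue T 1) with hl₁
  set A := tailNorm T 0
  set B := tailNorm T 1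
  have hAB : A ^ 2 = l₀ ^ 2 + B ^ 2 := tailNorm_zero_sq T
  have hl₀A : l₀ ≤ A := ofReal_orderedEigenvalue_le_tailNorm T 0
  have hl₁B : l₁ ≤ B := ofReal_orderedEigenvalue_le_tailNorm T 1
  have hBA : B ≤ A := by
    rw [← ENNReal.pow_le_pow_left_iff two_ne_zero, hAB]
    exact le_add_self
  have h3 : (3 : ℝ≥0∞) = ENNReal.ofReal 3 := by simp
  have h18 : ENNReal.ofReal 1.8 ^ 2 = ENNReal.ofReal 1.8 * ENNReal.ofReal 1.8 := sq _
  have h1 : 1 ≤ ENNReal.ofReal 1.8 := by rw [ENNReal.one_le_ofReal]; norm_num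
  have h1' : 1 ≤ ENNReal.ofReal (1 / 0.9) := by rw [ENNReal.one_le_ofReal]; norm_num
  unfold kappa
  split_ifs with hc₁ hc₂
  · have hinv : A⁻¹ = (A * A) ^ (-(1 / 2) : ℝ) := by
      rw [← sq, ← ENNReal.rpow_natCast, ← ENNReal.rpow_mul, ← ENNReal.rpow_neg_one]
      norm_num
    have h2 : A ^ 2 ≤ ENNReal.ofReal (3 / 2) * B ^ 2 := by
      have e1 : 2 * l₀ ^ 2 ≤ B ^ 2 := by
        have : l₀ ^ 2 + 2 * l₀ ^ 2 ≤ l₀ ^ 2 + B ^ 2 := by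
          rw [← hAB]
          refine le_trans (le_of_eq ?_) hc₁
          ring
        exact (ENNReal.add_le_add_iff_left (by simp [hl₀])).1 this
      have e2 : 2 * A ^ 2 ≤ 3 * B ^ 2 := by
        rw [hAB, mul_add]
        calc 2 * l₀ ^ 2 + 2 * B ^ 2 ≤ B ^ 2 + 2 * B ^ 2 := by gcongr
          _ = 3 * B ^ 2 := by ring
      have e3 : ENNReal.ofReal (3 / 2) = 2⁻¹ * 3 := by
        rw [show (3 / 2 : ℝ) = 2⁻¹ * 3 by norm_num, ENNReal.ofReal_mul (by norm_num),
          ENNReal.ofReal_inv_of_pos (by norm_num)]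
        simp
      rw [e3, mul_assoc]
      refine le_trans (le_of_eq ?_) (mul_le_mul_right e2 _)
      rw [← mul_assoc, ENNReal.inv_mul_cancel (by norm_num) (by norm_num), one_mul]
    rw [hinv]
    constructor
    · refine ofReal_mul_rpow_neg_half_le ?_
      have : A ≤ ENNReal.ofReal ((1 / 0.9) ^ 2) * B :=
        le_ofReal_mul_of_sq_le (by norm_num) (by norm_num) h2
      rw [← ENNReal.ofReal_pow (by norm_num), mul_left_comm]
      exact mul_le_mul_right this _
    · refine rpow_neg_half_le_mul (by norm_num) ?_
      calc A * B ≤ 1 * (A * A) := by rw [one_mul]; gcongr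
        _ ≤ _ := by gcongr; exact one_le_pow₀ h1
  · have hA : A ≤ ENNReal.ofReal 1.8 * l₀ :=
      le_ofReal_mul_of_sq_le (by norm_num) (q := 3) (by norm_num) (h3 ▸ (not_le.1 hc₁).le)
    constructor
    · refine ofReal_mul_rpow_neg_half_le ?_
      calc l₀ * B ≤ 1 * (A * B) := by rw [one_mul]; gcongr
        _ ≤ _ := by gcongr; exact one_le_pow₀ h1'
    · refine rpow_neg_half_le_mul (by norm_num) ?_
      rw [h18, mul_assoc]
      calc A * B ≤ (ENNReal.ofReal 1.8 * l₀) * B := by gcongr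
        _ = 1 * (ENNReal.ofReal 1.8 * (l₀ * B)) := by ring
        _ ≤ _ := by gcongr
  · have hA : A ≤ ENNReal.ofReal 1.8 * l₀ :=
      le_ofReal_mul_of_sq_le (by norm_num) (q := 3) (by norm_num) (h3 ▸ (not_le.1 hc₁).le)
    have hB : B ≤ ENNReal.ofReal 1.8 * l₁ :=
      le_ofReal_mul_of_sq_le (by norm_num) (q := 3) (by norm_num) (h3 ▸ (not_le.1 hc₂).le)
    constructor
    · refine ofReal_mul_rpow_neg_half_le ?_
      calc l₀ * l₁ ≤ 1 * (A * B) := by rw [one_mul]; gcongr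
        _ ≤ _ := by gcongr; exact one_le_pow₀ h1'
    · refine rpow_neg_half_le_mul (by norm_num) ?_
      calc A * B ≤ (ENNReal.ofReal 1.8 * l₀) * (ENNReal.ofReal 1.8 * l₁) := by gcongr
        _ = _ := by ring

/-! ### The density of the squared norm in terms of `kappa` -/

/-- The law of the squared distance to any point, for a Gaussian vector with the first `n` ordered
eigenvalues of `T` as variances and `n` large, has a density of order `kappa T`. -/
lemma exists_map_sqDist_le_kappa :
    ∃ C : ℝ≥0, ∀ (H : Type u) [NormedAddCommGroup H] [InnerProductSpace ℝ H] (T : H →L[ℝ] H),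
      Antitone (orderedEigenvalue T) → Summable (orderedEigenvalue T) → kappa T ≠ ⊤ →
      ∃ N : ℕ, ∀ n ≥ N, ∀ b : Fin n → ℝ,
        (gaussianPi fun i : Fin n ↦ (orderedEigenvalue T i).toNNReal).map (sqDist b) ≤
          (C * kappa T) • volume := by
  set c₁ := ∫ x : ℝ, (1 + x ^ 2) ^ (-(5 / 8) : ℝ) with hc₁
  set c₂ := ∫ x : ℝ, |x| ^ (-(1 / 2) : ℝ) * (1 + x ^ 2) ^ (-(5 / 8) : ℝ) with hc₂
  have hc₁0 : 0 ≤ c₁ := integral_nonneg fun x ↦ by positivity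
  have hc₂0 : 0 ≤ c₂ := integral_nonneg fun x ↦ by positivity
  -- The three summands serve the three cases in the definition of `kappa`.
  refine ⟨(c₁ + c₂ + 1).toNNReal, fun H _ _ T hanti hsum hκ ↦ ?_⟩
  set l := orderedEigenvalue T with hl
  have hl0 (n : ℕ) : 0 ≤ l n := orderedEigenvalue_nonneg T n
  have hcoe (n : ℕ) : ((l n).toNNReal : ℝ) = l n := Real.coe_toNNReal _ (hl0 n)
  have hsq : Summable fun n ↦ l n ^ 2 := by
    refine Summable.of_nonneg_of_le (fun n ↦ sq_nonneg _) (fun n ↦ ?_) (hsum.mul_left (l 0))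
    rw [sq]
    exact mul_le_mul_of_nonneg_right (hanti (Nat.zero_le n)) (hl0 n)
  have hsqk (k : ℕ) : Summable fun j ↦ l (k + j) ^ 2 := by
    simpa only [add_comm k] using (summable_nat_add_iff k).2 hsq
  set L : ℕ → ℝ := fun k ↦ ∑' j, l (k + j) ^ 2 with hL
  have hL0 (k : ℕ) : 0 ≤ L k := tsum_nonneg fun j ↦ sq_nonneg _
  have htsq (k : ℕ) : tailNorm T k ^ 2 = ENNReal.ofReal (L k) := by
    rw [tailNorm_sq, hL, ENNReal.ofReal_tsum_of_nonneg (fun j ↦ sq_nonneg _) (hsqk k)]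
    exact tsum_congr fun j ↦ (ENNReal.ofReal_pow (hl0 _) 2).symm
  have ht (k : ℕ) : tailNorm T k = ENNReal.ofReal (√(L k)) := by
    rw [← (ENNReal.pow_right_strictMono two_ne_zero).injective.eq_iff, htsq,
      ← ENNReal.ofReal_pow (Real.sqrt_nonneg _), Real.sq_sqrt (hL0 k)]
  have hcond (k : ℕ) : 3 * ENNReal.ofReal (l k) ^ 2 ≤ tailNorm T k ^ 2 ↔ 3 * l k ^ 2 ≤ L k := by
    rw [htsq, ← ENNReal.ofReal_pow (hl0 k), show (3 : ℝ≥0∞) = ENNReal.ofReal 3 by simp,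
      ← ENNReal.ofReal_mul (by norm_num), ENNReal.ofReal_le_ofReal_iff (hL0 k)]
  -- The truncation level depends on T; only the density constant has to be uniform.
  have hlarge (k : ℕ) (hk : 0 < L k) :
      ∃ N : ℕ, ∀ n ≥ N, 5 / 6 * L k ≤ ∑ i : Fin n, l (k + i) ^ 2 := by
    have := (hsqk k).hasSum.tendsto_sum_nat.eventually (lt_mem_nhds (by linarith : 5 / 6 * L k < L k))
    obtain ⟨N, hN⟩ := Filter.eventually_atTop.1 this
    exact ⟨N, fun n hn ↦ by
      rw [Fin.sum_univ_eq_sum_range (fun i ↦ l (k + i) ^ 2)]; exact (hN n hn).le⟩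
  have hC (c q : ℝ) (hc : c ≤ c₁ + c₂ + 1) (hq : 0 ≤ q) : ENNReal.ofReal (c * q) ≤
      ((c₁ + c₂ + 1).toNNReal : ℝ≥0∞) * ENNReal.ofReal q := by
    rw [← ENNReal.ofReal, ← ENNReal.ofReal_mul (by positivity)]
    exact ENNReal.ofReal_le_ofReal (mul_le_mul_of_nonneg_right hc hq)
  unfold kappa at hκ ⊢
  rw [← hl] at hκ ⊢
  simp only [hcond] at hκ ⊢
  split_ifs at hκ ⊢ with h₁ h₂
  · rw [ht] at hκ ⊢
    have hLpos : 0 < L 0 := by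
      rw [← Real.sqrt_pos]
      simpa using ENNReal.inv_ne_top.1 hκ
    obtain ⟨N, hN⟩ := hlarge 0 hLpos
    refine ⟨N, fun n hn b ↦ (map_sqDist_le_of_forall_le hLpos (fun i ↦ ?_) ?_ b).trans ?_⟩
    · rw [hcoe]
      refine le_trans ?_ h₁
      have := hanti (Nat.zero_le i)
      have := hl0 i
      gcongr
    · simpa only [hcoe, zero_add] using hN n hn
    · rw [← ENNReal.ofReal_inv_of_pos (Real.sqrt_pos.2 hLpos)]
      gcongr
      exact hC _ _ (by linarith) (by positivity)
  · rw [ht] at hκ ⊢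
    have hne : ENNReal.ofReal (l 0) * ENNReal.ofReal √(L 1) ≠ 0 := by
      intro h
      rw [h, ENNReal.zero_rpow_of_neg (by norm_num)] at hκ
      exact hκ rfl
    have hl0pos : 0 < l 0 := by simpa using left_ne_zero_of_mul hne
    have hLpos : 0 < L 1 := by simpa using right_ne_zero_of_mul hne
    obtain ⟨N, hN⟩ := hlarge 1 hLpos
    -- One more coordinate than `N`, since the dominating one is split off.
    refine ⟨N + 1, fun n hn b ↦ ?_⟩
    obtain ⟨m, rfl⟩ : ∃ m, n = m + 1 := ⟨n - 1, by omega⟩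
    refine (map_sqDist_le_of_forall_ne_le (k := 0) ?_ hLpos (fun i hi ↦ ?_) ?_ b).trans ?_
    · simpa using hl0pos
    · rw [hcoe]
      refine le_trans ?_ h₂
      have : 1 ≤ (i : ℕ) := Nat.one_le_iff_ne_zero.2 (Fin.val_ne_zero_iff.2 hi)
      have := hanti this
      have := hl0 i
      gcongr
    · have e := Finset.add_sum_erase Finset.univ
        (fun i : Fin (m + 1) ↦ ((l i).toNNReal : ℝ) ^ 2) (Finset.mem_univ 0)
      rw [Fin.sum_univ_succ, add_right_inj] at e
      rw [e]
      simp only [hcoe, Fin.val_succ]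
      simpa only [add_comm 1] using hN m (by omega)
    · rw [← ENNReal.ofReal_mul (hl0 0), ENNReal.ofReal_rpow_of_pos (by positivity), hcoe]
      gcongr
      exact hC _ _ (by linarith) (by positivity)
  · have hl1pos : 0 < l 1 := by
      rcases (hl0 1).eq_or_lt with h | h
      · exact absurd (by rw [← h]; simpa using hL0 1) h₂
      · exact h
    have hl0pos : 0 < l 0 := hl1pos.trans_le (hanti zero_le_one)
    refine ⟨2, fun n hn b ↦ ?_⟩
    refine (map_sqDist_le_of_ne (j := (⟨0, by omega⟩ : Fin n)) (k := ⟨1, by omega⟩)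
      (by rw [Ne, Fin.mk.injEq]; exact zero_ne_one)
      (by simpa using hl0pos) (by simpa using hl1pos) b).trans ?_
    simp only [hcoe]
    rw [← ENNReal.ofReal_mul (hl0 0), ENNReal.ofReal_rpow_of_pos (by positivity)]
    gcongr
    simpa using hC 1 _ (by linarith) (by positivity)

end GaussianComparison

namespace GaussianComparison

/-! ### Comparison of ball probabilities -/

section Finite

variable {ι : Type*} [Fintype ι]

/-- In this direction the shift and d cost nothing; only raising v to the pointwise maximum of v and
w is paid for. -/
lemma map_sqDist_Iic_sub_le {v : ι → ℝ≥0} {M : ℝ≥0∞}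
    (hM : ∀ b, (gaussianPi v).map (sqDist b) ≤ M • volume) (w : ι → ℝ≥0) (b : ι → ℝ) {d : ℝ}
    (hd : 0 ≤ d) (y : ℝ) :
    (gaussianPi v).map (sqDist b) (Set.Iic (y - d)) ≤
      (gaussianPi w).map (sqDist 0) (Set.Iic y) + M * ∑ i, ((w - v) i : ℝ≥0∞) :=
  calc (gaussianPi v).map (sqDist b) (Set.Iic (y - d))
    _ ≤ (gaussianPi v).map (sqDist b) (Set.Iic y) :=
      measure_mono (Set.Iic_subset_Iic.2 (by linarith))
    _ ≤ (gaussianPi v).map (sqDist 0) (Set.Iic y) := map_sqDist_Iic_le v b y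
    _ ≤ (gaussianPi (v + (w - v))).map (sqDist 0) (Set.Iic y) + M * ∑ i, ((w - v) i : ℝ≥0∞) :=
      map_sqDist_Iic_le_add hM (w - v) y
    _ ≤ _ := by
      -- Subtraction in `ℝ≥0` is truncated, so both sides are the pointwise maximum.
      have e : v + (w - v) = w + (v - w) := by
        ext1 i
        simp only [Pi.add_apply, Pi.sub_apply, add_tsub_eq_max, max_comm]
      rw [e]
      exact add_le_add_left (map_sqDist_add_Iic_le w (v - w) y) _

/-- Opposite direction: after passing from w to v at shift zero, an interval of length d pays for d
and the shift b costs its squared norm. -/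
lemma map_sqDist_zero_Iic_le {v w : ι → ℝ≥0} {M M' : ℝ≥0∞}
    (hM : ∀ b, (gaussianPi v).map (sqDist b) ≤ M • volume)
    (hM' : ∀ b, (gaussianPi w).map (sqDist b) ≤ M' • volume) (b : ι → ℝ) {d : ℝ}
    (hd : 0 ≤ d) (y : ℝ) :
    (gaussianPi w).map (sqDist 0) (Set.Iic y) ≤
      (gaussianPi v).map (sqDist b) (Set.Iic (y - d)) +
        (M * (∑ i, ENNReal.ofReal (b i ^ 2) + ENNReal.ofReal d) +
          M' * ∑ i, ((v - w) i : ℝ≥0∞)) := by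
  have h1 := map_sqDist_Iic_sub_le hM' v 0 le_rfl y
  rw [sub_zero] at h1
  refine h1.trans ?_
  rw [← add_assoc]
  gcongr
  have h2 : (gaussianPi v).map (sqDist 0) (Set.Iic y) ≤
      (gaussianPi v).map (sqDist 0) (Set.Iic (y - d)) + M * ENNReal.ofReal d := by
    have hsub : Set.Iic y ⊆ Set.Iic (y - d) ∪ Set.Ioc (y - d) y := by
      rw [Set.Iic_union_Ioc_eq_Iic (by linarith)]
    refine (measure_mono hsub).trans ((measure_union_le _ _).trans ?_)
    gcongr
    refine (hM 0 _).trans ?_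
    rw [Measure.smul_apply, Real.volume_Ioc, smul_eq_mul, sub_sub_cancel]
  rw [mul_add, ← add_assoc]
  exact h2.trans (add_le_add_left (map_sqDist_zero_Iic_le_add hM b (y - d)) _)

end Finite

lemma ofReal_abs_toReal_sub_le {p q K : ℝ≥0∞} (hp : p ≠ ⊤) (hq : q ≠ ⊤) (h₁ : p ≤ q + K)
    (h₂ : q ≤ p + K) : ENNReal.ofReal |p.toReal - q.toReal| ≤ K := by
  rcases eq_or_ne K ⊤ with rfl | hK
  · exact le_top
  refine ENNReal.ofReal_le_of_le_toReal (abs_sub_le_iff.2 ⟨?_, ?_⟩)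
  · have := ENNReal.toReal_mono (ENNReal.add_ne_top.2 ⟨hq, hK⟩) h₁
    rw [ENNReal.toReal_add hq hK] at this
    linarith
  · have := ENNReal.toReal_mono (ENNReal.add_ne_top.2 ⟨hp, hK⟩) h₂
    rw [ENNReal.toReal_add hp hK] at this
    linarith

variable {H : Type u} [NormedAddCommGroup H] [InnerProductSpace ℝ H]

lemma sum_toNNReal_sub_le_eigenvalueDist (S T : H →L[ℝ] H) (n : ℕ) :
    ∑ i : Fin n, (((fun i : Fin n ↦ (orderedEigenvalue S i).toNNReal) -
      fun i : Fin n ↦ (orderedEigenvalue T i).toNNReal) i : ℝ≥0∞) ≤ eigenvalueDist S T := by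
  refine le_trans (Finset.sum_le_sum (g := fun i : Fin n ↦
    ENNReal.ofReal |orderedEigenvalue S i - orderedEigenvalue T i|) fun i _ ↦ ?_) ?_
  · rw [Pi.sub_apply, ENNReal.ofReal, ENNReal.coe_le_coe, tsub_le_iff_right]
    refine Real.toNNReal_le_iff_le_coe.2 ?_
    push_cast
    rw [Real.coe_toNNReal _ (abs_nonneg _), Real.coe_toNNReal _ (orderedEigenvalue_nonneg T i)]
    linarith [le_abs_self (orderedEigenvalue S i - orderedEigenvalue T i)]
  · rw [Fin.sum_univ_eq_sum_range
      (fun i ↦ ENNReal.ofReal |orderedEigenvalue S i - orderedEigenvalue T i|)]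
    exact ENNReal.sum_le_tsum _

lemma eigenvalueDist_comm (S T : H →L[ℝ] H) : eigenvalueDist S T = eigenvalueDist T S := by
  simp only [eigenvalueDist, abs_sub_comm]

/-! ### From finitely many coordinates to balls in the Hilbert space -/

variable [MeasurableSpace H] [BorelSpace H]
  {Ω : Type v} [MeasurableSpace Ω] {P : Measure Ω} [IsProbabilityMeasure P]

/-- The events that the partial sums are at most x² − d decrease to the ball event almost surely, so
continuity from above applies. -/
lemma tendsto_map_sqDist {ξ : Ω → H} (hξ : AEMeasurable ξ P) {f : ℕ → H} {l : ℕ → ℝ≥0}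
    (hlaw : ∀ n : ℕ, P.map (fun ω (i : Fin n) ↦ inner ℝ (f i) (ξ ω)) =
      gaussianPi fun i : Fin n ↦ l i) {a : H} {d x : ℝ} (hx : 0 < x)
    (hsum : ∀ᵐ ω ∂P, HasSum (fun n ↦ (inner ℝ (f n) (ξ ω) - inner ℝ (f n) a) ^ 2)
      (‖ξ ω - a‖ ^ 2 - d)) :
    Filter.Tendsto (fun n : ℕ ↦ (gaussianPi fun i : Fin n ↦ l i).map
      (sqDist fun i : Fin n ↦ inner ℝ (f i) a) (Set.Iic (x ^ 2 - d))) Filter.atTop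
      (nhds (P {ω | ‖ξ ω - a‖ ≤ x})) := by
  have hX (g : H) : AEMeasurable (fun ω ↦ inner ℝ g (ξ ω)) P :=
    (by fun_prop : Measurable fun z : H ↦ inner ℝ g z).comp_aemeasurable hξ
  let A : ℕ → Set Ω := fun n ↦
    {ω | ∑ i ∈ Finset.range n, (inner ℝ (f i) (ξ ω) - inner ℝ (f i) a) ^ 2 ≤ x ^ 2 - d}
  have h1 (n : ℕ) : (gaussianPi fun i : Fin n ↦ l i).map
      (sqDist fun i : Fin n ↦ inner ℝ (f i) a) (Set.Iic (x ^ 2 - d)) = P (A n) := by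
    rw [← hlaw n, AEMeasurable.map_map_of_aemeasurable (by fun_prop)
      (aemeasurable_pi_lambda _ fun i ↦ hX _), Measure.map_apply_of_aemeasurable
      ((measurable_sqDist _).comp_aemeasurable (aemeasurable_pi_lambda _ fun i ↦ hX _))
      measurableSet_Iic]
    congr 1
    ext ω
    simp only [A, Set.mem_preimage, Function.comp_apply, Set.mem_Iic, sqDist, Set.mem_ofPred_eq]
    rw [Fin.sum_univ_eq_sum_range (fun i ↦ (inner ℝ (f i) (ξ ω) - inner ℝ (f i) a) ^ 2)]
  have h2 : P {ω | ‖ξ ω - a‖ ≤ x} = P (⋂ n, A n) := by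
    refine measure_congr ?_
    filter_upwards [hsum] with ω hω
    refine propext ?_
    change ‖ξ ω - a‖ ≤ x ↔ ω ∈ ⋂ n, A n
    rw [Set.mem_iInter, ← sq_le_sq₀ (norm_nonneg _) hx.le,
      ← sub_le_sub_iff_right (c := d) (a := ‖ξ ω - a‖ ^ 2)]
    constructor
    · intro h n
      exact (sum_le_hasSum _ (fun i _ ↦ sq_nonneg _) hω).trans h
    · intro h
      exact le_of_tendsto' hω.tendsto_sum_nat h
  simp only [h1]
  rw [h2]
  refine tendsto_measure_iInter_atTop (fun n ↦ ?_) (fun m n hmn ω hω ↦ ?_)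
    ⟨0, measure_ne_top _ _⟩
  · have : AEMeasurable (fun ω ↦ ∑ i ∈ Finset.range n,
        (inner ℝ (f i) (ξ ω) - inner ℝ (f i) a) ^ 2) P :=
      Finset.aemeasurable_fun_sum _ fun i _ ↦ ((hX (f i)).sub_const _).pow_const 2
    exact nullMeasurableSet_le this aemeasurable_const
  · have hω' : ∑ i ∈ Finset.range n, (inner ℝ (f i) (ξ ω) - inner ℝ (f i) a) ^ 2 ≤ x ^ 2 - d := hω
    exact (Finset.sum_le_sum_of_subset_of_nonneg (Finset.range_subset_range.2 hmn)
      fun i _ _ ↦ sq_nonneg _).trans hω'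

variable [CompleteSpace H] [TopologicalSpace.SeparableSpace H]

lemma exists_tendsto_ball_zero {η : Ω → H} (hη : HasGaussianLaw η P) (hη0 : ∫ ω, η ω ∂P = 0)
    {x : ℝ} (hx : 0 < x) :
    Filter.Tendsto (fun n : ℕ ↦ (gaussianPi fun i : Fin n ↦ (orderedEigenvalue
      (covarianceOperator (P.map η)) i).toNNReal).map (sqDist 0) (Set.Iic (x ^ 2))) Filter.atTop
      (nhds (P {ω | ‖η ω‖ ≤ x})) := by
  have : SecondCountableTopology H := UniformSpace.secondCountable_of_separable H
  obtain ⟨-, -, g, hg, hga⟩ := exists_gaussian_coordinates hη hη0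
  obtain ⟨e, he, hea, hes⟩ := hga 0
  have he0 : e = 0 := by
    simp only [inner_zero_right, norm_zero] at hea
    have h0 : HasSum (fun _ : ℕ ↦ (0 : ℝ) ^ 2) 0 := by simp
    have := hea.unique h0
    linarith
  have h := tendsto_map_sqDist hη.aemeasurable (l := fun n ↦ (orderedEigenvalue
      (covarianceOperator (P.map η)) n).toNNReal) hg hx hes
  simp only [he0, sub_zero, inner_zero_right] at h
  exact h

/-- The comparison of ball probabilities, given density bounds for finitely many coordinates. -/
lemma ball_comparison {ξ η : Ω → H} (hξ : HasGaussianLaw ξ P) (hη : HasGaussianLaw η P)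
    (hξ0 : ∫ ω, ξ ω ∂P = 0) (hη0 : ∫ ω, η ω ∂P = 0) (a : H) {C : ℝ≥0∞} {N : ℕ}
    (hCξ : ∀ n ≥ N, ∀ b : Fin n → ℝ, (gaussianPi fun i : Fin n ↦ (orderedEigenvalue
      (covarianceOperator (P.map ξ)) i).toNNReal).map (sqDist b) ≤ C • volume)
    (hCη : ∀ n ≥ N, ∀ b : Fin n → ℝ, (gaussianPi fun i : Fin n ↦ (orderedEigenvalue
      (covarianceOperator (P.map η)) i).toNNReal).map (sqDist b) ≤ C • volume)
    {x : ℝ} (hx : 0 < x) :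
    ENNReal.ofReal |P.real {ω | ‖ξ ω - a‖ ≤ x} - P.real {ω | ‖η ω‖ ≤ x}| ≤
      C * (eigenvalueDist (covarianceOperator (P.map ξ)) (covarianceOperator (P.map η)) +
        ENNReal.ofReal (‖a‖ ^ 2)) := by
  have : SecondCountableTopology H := UniformSpace.secondCountable_of_separable H
  set S := covarianceOperator (P.map ξ)
  set T := covarianceOperator (P.map η)
  obtain ⟨-, -, f, hf, hfa⟩ := exists_gaussian_coordinates hξ hξ0
  obtain ⟨d, hd, hda, hds⟩ := hfa a
  have t₁ := tendsto_map_sqDist hξ.aemeasurable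
    (l := fun n ↦ (orderedEigenvalue S n).toNNReal) hf hx hds
  have t₂ := exists_tendsto_ball_zero hη hη0 hx
  have hab (n : ℕ) : ∑ i : Fin n, ENNReal.ofReal (inner ℝ (f i) a ^ 2) + ENNReal.ofReal d ≤
      ENNReal.ofReal (‖a‖ ^ 2) := by
    rw [← ENNReal.ofReal_sum_of_nonneg fun i _ ↦ sq_nonneg _,
      ← ENNReal.ofReal_add (Finset.sum_nonneg fun i _ ↦ sq_nonneg _) hd]
    refine ENNReal.ofReal_le_ofReal ?_
    have := sum_le_hasSum (Finset.range n) (fun i _ ↦ sq_nonneg _) hda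
    rw [Fin.sum_univ_eq_sum_range (fun i ↦ inner ℝ (f i) a ^ 2)]
    linarith
  refine ofReal_abs_toReal_sub_le (measure_ne_top _ _) (measure_ne_top _ _) ?_ ?_
  · refine le_of_tendsto_of_tendsto t₁ (t₂.add tendsto_const_nhds)
      (Filter.eventually_atTop.2 ⟨N, fun n hn ↦ ?_⟩)
    refine (map_sqDist_Iic_sub_le (hCξ n hn) (fun i : Fin n ↦ (orderedEigenvalue T i).toNNReal) _ hd
      _).trans ?_
    refine add_le_add_right (mul_le_mul_right ?_ _) _
    refine (sum_toNNReal_sub_le_eigenvalueDist T S n).trans ?_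
    rw [eigenvalueDist_comm]
    exact le_self_add
  · refine le_of_tendsto_of_tendsto t₂ (t₁.add tendsto_const_nhds)
      (Filter.eventually_atTop.2 ⟨N, fun n hn ↦ ?_⟩)
    refine (map_sqDist_zero_Iic_le (hCξ n hn) (hCη n hn)
      (fun i : Fin n ↦ inner ℝ (f i) a) hd _).trans ?_
    rw [← mul_add]
    refine add_le_add_right (mul_le_mul_right ?_ _) _
    rw [add_comm (eigenvalueDist S T)]
    exact add_le_add (hab n) (sum_toNNReal_sub_le_eigenvalueDist S T n)

/-- This covers the convention ∞ · 0 = 0, where no density bound is available: the ball probability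
is a limit depending only on the eigenvalues. -/
lemma ball_measure_eq {ξ η : Ω → H} (hξ : HasGaussianLaw ξ P) (hη : HasGaussianLaw η P)
    (hξ0 : ∫ ω, ξ ω ∂P = 0) (hη0 : ∫ ω, η ω ∂P = 0)
    (h : eigenvalueDist (covarianceOperator (P.map ξ)) (covarianceOperator (P.map η)) = 0)
    {x : ℝ} (hx : 0 < x) : P {ω | ‖ξ ω‖ ≤ x} = P {ω | ‖η ω‖ ≤ x} := by
  have h' : orderedEigenvalue (covarianceOperator (P.map ξ)) =
      orderedEigenvalue (covarianceOperator (P.map η)) := by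
    ext j
    have := ENNReal.tsum_eq_zero.1 h j
    rw [ENNReal.ofReal_eq_zero, abs_nonpos_iff, sub_eq_zero] at this
    exact this
  have t₁ := exists_tendsto_ball_zero hξ hξ0 hx
  rw [h'] at t₁
  exact tendsto_nhds_unique t₁ (exists_tendsto_ball_zero hη hη0 hx)

end GaussianComparison

end

/-! ### Assembly of the main theorem -/

theorem mainTheorem1 :
    (∃ C : ℝ≥0, ∀ (H : Type u) [NormedAddCommGroup H] [InnerProductSpace ℝ H] [CompleteSpace H]
      [TopologicalSpace.SeparableSpace H] [MeasurableSpace H] [BorelSpace H]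
      (Ω : Type v) [MeasurableSpace Ω] (P : Measure Ω) [IsProbabilityMeasure P]
      (ξ η : Ω → H), HasGaussianLaw ξ P → HasGaussianLaw η P →
      ∫ ω, ξ ω ∂P = 0 → ∫ ω, η ω ∂P = 0 → ∀ a : H,
      (⨆ (x : ℝ) (_ : 0 < x),
        ENNReal.ofReal |P.real {ω | ‖ξ ω - a‖ ≤ x} - P.real {ω | ‖η ω‖ ≤ x}|) ≤
      C * (GaussianComparison.kappa (covarianceOperator (P.map ξ)) +
          GaussianComparison.kappa (covarianceOperator (P.map η))) *
        (GaussianComparison.eigenvalueDist (covarianceOperator (P.map ξ))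
          (covarianceOperator (P.map η)) + ENNReal.ofReal (‖a‖ ^ 2))) ∧
    (∀ (H : Type u) [NormedAddCommGroup H] [InnerProductSpace ℝ H] [CompleteSpace H]
      [TopologicalSpace.SeparableSpace H] [MeasurableSpace H] [BorelSpace H]
      (Ω : Type v) [MeasurableSpace Ω] (P : Measure Ω) [IsProbabilityMeasure P]
      (ξ : Ω → H), HasGaussianLaw ξ P → ∫ ω, ξ ω ∂P = 0 →
      ENNReal.ofReal 0.9 *
          (GaussianComparison.tailNorm (covarianceOperator (P.map ξ)) 0 *
            GaussianComparison.tailNorm (covarianceOperator (P.map ξ)) 1) ^ (-(1 / 2) : ℝ) ≤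
        GaussianComparison.kappa (covarianceOperator (P.map ξ)) ∧
      GaussianComparison.kappa (covarianceOperator (P.map ξ)) ≤
        ENNReal.ofReal 1.8 *
          (GaussianComparison.tailNorm (covarianceOperator (P.map ξ)) 0 *
            GaussianComparison.tailNorm (covarianceOperator (P.map ξ)) 1) ^ (-(1 / 2) : ℝ)) := by
  refine ⟨?_, fun H _ _ _ _ _ _ Ω _ P _ ξ _ _ ↦ GaussianComparison.kappa_bounds _⟩
  obtain ⟨C, hC⟩ := GaussianComparison.exists_map_sqDist_le_kappa.{u}
  -- The added 1 makes the constant nonzero, so that the right-hand side is ∞ when some ϰ is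
  -- infinite and the second factor is positive.
  refine ⟨C + 1, fun H _ _ _ _ _ _ Ω _ P _ ξ η hξ hη hξ0 hη0 a ↦ iSup₂_le fun x hx ↦ ?_⟩
  have : SecondCountableTopology H := UniformSpace.secondCountable_of_separable H
  by_cases hD : GaussianComparison.eigenvalueDist (covarianceOperator (P.map ξ))
      (covarianceOperator (P.map η)) + ENNReal.ofReal (‖a‖ ^ 2) = 0
  · obtain ⟨h₁, h₂⟩ := add_eq_zero.1 hD
    have ha : a = 0 := by
      rw [ENNReal.ofReal_eq_zero] at h₂
      exact norm_eq_zero.1 (pow_eq_zero_iff two_ne_zero |>.1 (le_antisymm h₂ (sq_nonneg _)))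
    simp [ha, measureReal_def, GaussianComparison.ball_measure_eq hξ hη hξ0 hη0 h₁ hx]
  by_cases hκ : GaussianComparison.kappa (covarianceOperator (P.map ξ)) +
      GaussianComparison.kappa (covarianceOperator (P.map η)) = ⊤
  · rw [hκ, ENNReal.mul_top (by simp), ENNReal.top_mul hD]
    exact le_top
  obtain ⟨hκξ, hκη⟩ := ENNReal.add_ne_top.1 hκ
  obtain ⟨hξa, hξs, -⟩ := GaussianComparison.exists_gaussian_coordinates hξ hξ0
  obtain ⟨hηa, hηs, -⟩ := GaussianComparison.exists_gaussian_coordinates hη hη0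
  obtain ⟨N₁, hN₁⟩ := hC H _ hξa hξs hκξ
  obtain ⟨N₂, hN₂⟩ := hC H _ hηa hηs hκη
  refine GaussianComparison.ball_comparison hξ hη hξ0 hη0 a (N := max N₁ N₂)
    (fun n hn b ↦ (hN₁ n (le_of_max_le_left hn) b).trans ?_)
    (fun n hn b ↦ (hN₂ n (le_of_max_le_right hn) b).trans ?_) hx
  · gcongr
    · simp
    · exact le_self_add
  · gcongr
    · simp
    · exact le_add_self
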